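/- **Theorem 5 (Asymptotic Expression of Lower Bound).** Fix real numbers $\sigma_X^2>0$, $\sigma_Z^2\ge 0$ and $\rho_X,\rho_Z\in[0,1]$. Put $\sigma_Y^2=\sigma_X^2+\sigma_Z^2$ and $\rho_Y=\frac{\rho_X\sigma_X^2+\rho_Z\sigma_Z^2}{\sigma_Y^2}$, and for $*\in\{X,Y,Z\}$ and an integer $L\ge 1$ let $\lambda_*=(1+(L-1)\rho_*)\sigma_*^2$ and $\gamma_*=(1-\rho_*)\sigma_*^2$. Assume $\gamma_Y>0$ and let $\lambda_W=\min(\lambda_Y,\gamma_Y)$. For $D\in\mathbb R$ let $\underline{\mathcal R}(D)$ (which depends on $L$) be the minimum of $$\Omega(\alpha,\beta,\delta)=\tfrac12\log\frac{\lambda_Y^2}{(\lambda_Y-\lambda_W)\alpha+\lambda_Y\lambda_W}+\tfrac{L-1}{2}\log\frac{\gamma_Y^2}{(\gamma_Y-\lambda_W)\beta+\gamma_Y\lambda_W}+\tfrac L2\log\frac{\lambda_W}{\delta}$$ over all $(\alpha,\beta,\delta)$ with $0<\alpha\le\lambda_Y$, $0<\beta\le\gamma_Y$, $0<\delta\le(\alpha^{-1}+\lambda_W^{-1}-\lambda_Y^{-1})^{-1}$,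 $\delta\le(\beta^{-1}+\lambda_W^{-1}-\gamma_Y^{-1})^{-1}$ and $$\lambda_X^2\lambda_Y^{-2}\alpha+\lambda_X-\lambda_X^2\lambda_Y^{-1}+(L-1)\left(\gamma_X^2\gamma_Y^{-2}\beta+\gamma_X-\gamma_X^2\gamma_Y^{-1}\right)\le LD .$$ Write $s=\rho_X\sigma_X^2+\rho_Z\sigma_Z^2$. Define $d^\infty_{\min}=\frac{\sigma_X^2\sigma_Z^2}{\sigma_X^2+\sigma_Z^2}$ if $s=0$ and $d^\infty_{\min}=\frac{\rho_X\rho_Z\sigma_X^2\sigma_Z^2}{s}+\gamma_X\gamma_Z\gamma_Y^{-1}$ if $s>0$. For $s>0$ define $$\mathsf D^\infty_{\text{th},0}=\frac{\rho_X\rho_Z\sigma_X^2\sigma_Z^2}{s}+\gamma_X,\qquad \xi=\frac{\rho_X}{1-\rho_X}\cdot\frac{1-\rho_Y}{\rho_Y}$$ (with $\xi=+\infty$ if $\rho_X=1$) and, if $\xi\le\frac12$, $$\mathsf D^\infty_{\text{th},1}=\mathsf D^\infty_{\text{th},0}-\frac{1+\sqrt{1-4\xi^2}}{2}\gamma_X^2\gamma_Y^{-1},\qquad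 \mathsf D^\infty_{\text{th},2}=\mathsf D^\infty_{\text{th},0}-\frac{1-\sqrt{1-4\xi^2}}{2}\gamma_X^2\gamma_Y^{-1}.$$ Let $$\overline{\mathcal R}^\infty(D)=\tfrac L2\log\frac{\sigma_X^4}{(\sigma_X^2+\sigma_Z^2)D-\sigma_X^2\sigma_Z^2},$$ $$\overline{\mathcal R}^\infty_1(D)=\tfrac L2\log\frac{\gamma_X^2\gamma_Y^{-1}}{D-d^\infty_{\min}}+\tfrac12\log L+\tfrac12\log\frac{s(\mathsf D^\infty_{\text{th},0}-D)}{\gamma_X^2}+\frac{(\mathsf D^\infty_{\text{th},0}-\xi\gamma_X^2\gamma_Y^{-1}-D)^2}{2(\mathsf D^\infty_{\text{th},0}-D)(D-d^\infty_{\min})}+O\!\left(\tfrac1L\right),$$ $$\overline{\mathcal R}^\infty_2(D)=\tfrac12\xi\sqrt L+\tfrac14\log L+\tfrac12\log\frac{\rho_X}{1-\rho_X}-\frac{\xi\left(\rho_X\gamma_X-\gamma_Z+(1-\rho_X^2)\sigma_Z^2\right)}{4(1-\rho_X)(\rho_X^2\sigma_X^2+\rho_X\rho_Z\sigma_Z^2)}+O\!\left(\tfrac1{\sqrt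 L}\right),$$ $$\overline{\mathcal R}^\infty_3(D)=\tfrac12\log\frac{\rho_X^2\sigma_X^4}{s(D-\mathsf D^\infty_{\text{th},0})}+\frac{(1-\rho_Y)(\sigma_X^2-D)}{2\rho_Y(D-\mathsf D^\infty_{\text{th},0})}+O\!\left(\tfrac1L\right),$$ $$\underline{\mathcal R}^\infty_1(D)=\tfrac{L+1}2\log\frac{\gamma_X^2\gamma_Y^{-1}}{D-d^\infty_{\min}}+\tfrac12\log L+\tfrac12\frac{(1-2\xi)\gamma_X^2\gamma_Y^{-1}}{D-d^\infty_{\min}}+\tfrac12\log\frac{\rho_X^2(1-\rho_Y)}{(1-\rho_X)^2\rho_Y}+O\!\left(\tfrac1L\right),$$ $$\underline{\mathcal R}^\infty_2(D)=\tfrac L2\log\frac{\sigma_X^4}{\gamma_YD-\sigma_X^2\gamma_Z}-\tfrac12\frac{D-\sigma_X^2}{D-\sigma_X^2+\sigma_X^4\gamma_Y^{-1}}+O\!\left(\tfrac1L\right).$$ Let $D\in(d^\infty_{\min},\sigma_X^2)$ be fixed; all $O(\cdot)$ are for $L\to\infty$ with $D,\sigma_X^2,\sigma_Z^2,\rho_X,\rho_Z$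 fixed. Then the minimum defining $\underline{\mathcal R}(D)$ exists for all sufficiently large $L$, and: 1. If $s=0$, then $\underline{\mathcal R}(D)=\overline{\mathcal R}^\infty(D)$ (exactly, for every $L\ge1$). 2. If $s>0$, $\rho_X>0$ and $\xi\ge\frac12$, then $\underline{\mathcal R}(D)$ equals $\overline{\mathcal R}^\infty_1(D)$ if $D<\mathsf D^\infty_{\text{th},0}$, $\overline{\mathcal R}^\infty_2(D)$ if $D=\mathsf D^\infty_{\text{th},0}$, and $\overline{\mathcal R}^\infty_3(D)$ if $D>\mathsf D^\infty_{\text{th},0}$. 3. If $s>0$, $\rho_X>0$ and $\xi<\frac12$, then $\underline{\mathcal R}(D)$ equals $\overline{\mathcal R}^\infty_1(D)$ if $D\le\mathsf D^\infty_{\text{th},1}$, $\underline{\mathcal R}^\infty_1(D)$ if $\mathsf D^\infty_{\text{th},1}<D<\mathsf D^\infty_{\text{th},2}$, $\overline{\mathcal R}^\infty_1(D)$ if $\mathsf D^\infty_{\text{th},2}\le D<\mathsf D^\infty_{\text{th},0}$, $\overline{\mathcal R}^\infty_2(D)$ if $D=\mathsf D^\infty_{\text{th},0}$, and $\overline{\mathcal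 R}^\infty_3(D)$ if $D>\mathsf D^\infty_{\text{th},0}$. 4. If $s>0$ and $\rho_X=0$, then $\underline{\mathcal R}(D)=\underline{\mathcal R}^\infty_2(D)$. -/

import Mathlib

open Filter Asymptotics

noncomputable section

/-- Parameters of the symmetric Gaussian model `Y_ℓ = X_ℓ + Z_ℓ`: the source vector `X` and the
independent noise vector `Z` are centred Gaussian; every coordinate of `X` has variance
`varX = σ_X²` and any two coordinates have correlation coefficient `rhoX`; likewise for `Z`. -/
structure SymGauss where
  varX : ℝ
  varZ : ℝ
  rhoX : ℝ
  rhoZ : ℝ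

namespace SymGauss

variable (p : SymGauss)

/-- `σ_Y²`, the variance of the coordinates of `Y = X + Z`. -/
def varY : ℝ := p.varX + p.varZ

/-- `ρ_X σ_X² + ρ_Z σ_Z²`, the covariance of two distinct coordinates of `Y`. -/
def covY : ℝ := p.rhoX * p.varX + p.rhoZ * p.varZ

/-- `ρ_Y`, the correlation coefficient of two distinct coordinates of `Y`. -/
def rhoY : ℝ := p.covY / p.varY

/-- The eigenvalue `λ_X = (1 + (L - 1) ρ_X) σ_X²` of the covariance matrix of `X`. -/
def lamX (L : ℕ) : ℝ := (1 + ((L : ℝ) - 1) * p.rhoX) * p.varX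

/-- The eigenvalue `λ_Y = (1 + (L - 1) ρ_Y) σ_Y²` of the covariance matrix of `Y`. -/
def lamY (L : ℕ) : ℝ := (1 + ((L : ℝ) - 1) * p.rhoY) * p.varY

/-- The eigenvalue `γ_X = (1 - ρ_X) σ_X²` (of multiplicity `L - 1`). -/
def gamX : ℝ := (1 - p.rhoX) * p.varX

/-- The eigenvalue `γ_Z = (1 - ρ_Z) σ_Z²` (of multiplicity `L - 1`). -/
def gamZ : ℝ := (1 - p.rhoZ) * p.varZ

/-- The eigenvalue `γ_Y = (1 - ρ_Y) σ_Y²` (of multiplicity `L - 1`). -/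
def gamY : ℝ := (1 - p.rhoY) * p.varY

/-- `λ_W = min(λ_Y, γ_Y)`. -/
def lamW (L : ℕ) : ℝ := min (p.lamY L) p.gamY

/-- The objective function `Ω(α, β, δ)` of the lower-bound program. -/
def Omega (L : ℕ) (α β δ : ℝ) : ℝ :=
  1 / 2 * Real.log (p.lamY L ^ 2 / ((p.lamY L - p.lamW L) * α + p.lamY L * p.lamW L))
    + ((L : ℝ) - 1) / 2 *
        Real.log (p.gamY ^ 2 / ((p.gamY - p.lamW L) * β + p.gamY * p.lamW L))
    + (L : ℝ) / 2 * Real.log (p.lamW L / δ)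

/-- The constraints of the lower-bound program. -/
structure Feasible (L : ℕ) (D α β δ : ℝ) : Prop where
  alpha_pos : 0 < α
  alpha_le : α ≤ p.lamY L
  beta_pos : 0 < β
  beta_le : β ≤ p.gamY
  delta_pos : 0 < δ
  delta_le_alpha : δ ≤ (α⁻¹ + (p.lamW L)⁻¹ - (p.lamY L)⁻¹)⁻¹
  delta_le_beta : δ ≤ (β⁻¹ + (p.lamW L)⁻¹ - p.gamY⁻¹)⁻¹
  distortion :
    p.lamX L ^ 2 * (p.lamY L ^ 2)⁻¹ * α + p.lamX L - p.lamX L ^ 2 * (p.lamY L)⁻¹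
      + ((L : ℝ) - 1) *
        (p.gamX ^ 2 * (p.gamY ^ 2)⁻¹ * β + p.gamX - p.gamX ^ 2 * p.gamY⁻¹) ≤ (L : ℝ) * D

/-- The values of `Ω` at the feasible points. -/
def values (L : ℕ) (D : ℝ) : Set ℝ :=
  {r | ∃ α β δ : ℝ, p.Feasible L D α β δ ∧ r = p.Omega L α β δ}

/-- The lower bound on the rate-distortion function for `L` sources at distortion `D`: the optimal
value of the program. -/
def lowerR (L : ℕ) (D : ℝ) : ℝ := sInf (p.values L D)

/-- `d_min^∞`. -/
def dminInf : ℝ :=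
  if p.covY = 0 then p.varX * p.varZ / (p.varX + p.varZ)
  else p.rhoX * p.rhoZ * p.varX * p.varZ / p.covY + p.gamX * p.gamZ * p.gamY⁻¹

/-- `D_{th,0}^∞`. -/
def Dth0 : ℝ := p.rhoX * p.rhoZ * p.varX * p.varZ / p.covY + p.gamX

/-- `ξ = (ρ_X / (1 - ρ_X)) ((1 - ρ_Y) / ρ_Y)`, meaningful for `ρ_X < 1` only
(for `ρ_X = 1` it is read as `+∞`, and this case is treated separately below). -/
def xi : ℝ := p.rhoX / (1 - p.rhoX) * ((1 - p.rhoY) / p.rhoY)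

/-- `D_{th,1}^∞`. -/
def Dth1 : ℝ := p.Dth0 - (1 + √(1 - 4 * p.xi ^ 2)) / 2 * (p.gamX ^ 2 * p.gamY⁻¹)

/-- `D_{th,2}^∞`. -/
def Dth2 : ℝ := p.Dth0 - (1 - √(1 - 4 * p.xi ^ 2)) / 2 * (p.gamX ^ 2 * p.gamY⁻¹)

/-- The expression for uncorrelated coordinates (`ρ_X σ_X² + ρ_Z σ_Z² = 0`). -/
def upperInf (L : ℕ) (D : ℝ) : ℝ :=
  (L : ℝ) / 2 * Real.log (p.varX ^ 2 / ((p.varX + p.varZ) * D - p.varX * p.varZ))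

/-- The first upper-bound expression, without its `O(1/L)` term. -/
def upperInf1 (L : ℕ) (D : ℝ) : ℝ :=
  (L : ℝ) / 2 * Real.log (p.gamX ^ 2 * p.gamY⁻¹ / (D - p.dminInf))
    + 1 / 2 * Real.log (L : ℝ)
    + 1 / 2 * Real.log (p.covY * (p.Dth0 - D) / p.gamX ^ 2)
    + (p.Dth0 - p.xi * (p.gamX ^ 2 * p.gamY⁻¹) - D) ^ 2 / (2 * (p.Dth0 - D) * (D - p.dminInf))

/-- The second upper-bound expression (for `D = D_{th,0}^∞`), without its `O(1/√L)` term. -/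
def upperInf2 (L : ℕ) : ℝ :=
  1 / 2 * p.xi * √(L : ℝ) + 1 / 4 * Real.log (L : ℝ)
    + 1 / 2 * Real.log (p.rhoX / (1 - p.rhoX))
    - p.xi * (p.rhoX * p.gamX - p.gamZ + (1 - p.rhoX ^ 2) * p.varZ)
      / (4 * (1 - p.rhoX) * (p.rhoX ^ 2 * p.varX + p.rhoX * p.rhoZ * p.varZ))

/-- The third upper-bound expression, without its `O(1/L)` term. -/
def upperInf3 (D : ℝ) : ℝ :=
  1 / 2 * Real.log (p.rhoX ^ 2 * p.varX ^ 2 / (p.covY * (D - p.Dth0)))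
    + (1 - p.rhoY) * (p.varX - D) / (2 * p.rhoY * (D - p.Dth0))

/-- The first lower-bound expression, without its `O(1/L)` term. -/
def lowerInf1 (L : ℕ) (D : ℝ) : ℝ :=
  ((L : ℝ) + 1) / 2 * Real.log (p.gamX ^ 2 * p.gamY⁻¹ / (D - p.dminInf))
    + 1 / 2 * Real.log (L : ℝ)
    + 1 / 2 * ((1 - 2 * p.xi) * (p.gamX ^ 2 * p.gamY⁻¹) / (D - p.dminInf))
    + 1 / 2 * Real.log (p.rhoX ^ 2 * (1 - p.rhoY) / ((1 - p.rhoX) ^ 2 * p.rhoY))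

/-- The second lower-bound expression (for `ρ_X = 0`), without its `O(1/L)` term. -/
def lowerInf2 (L : ℕ) (D : ℝ) : ℝ :=
  (L : ℝ) / 2 * Real.log (p.varX ^ 2 / (p.gamY * D - p.varX * p.gamZ))
    - 1 / 2 * ((D - p.varX) / (D - p.varX + p.varX ^ 2 * p.gamY⁻¹))

end SymGauss

end

noncomputable section
namespace SymGauss

/-! Because `covY` is nonnegative, `lamW = gamY`. The middle logarithm of `Omega` then vanishes and
the second bound on `δ` becomes `δ ≤ β`, so one may take `β = δ` (`omega_eq`, `feasible_diag`). What
remains is a convex program in `(α, δ)`: minus a sum of logarithms of affine functions is minimised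
under a linear distortion constraint, `α ≤ lamY`, and `δ ≤ cap α` with `cap` concave. First-order
conditions are therefore sufficient (`isLeast_of_gradient`).

When `covY > 0`, the optimum lies on the distortion line. There `δ ≤ cap α` reads `α ≥ cross`, and
the objective is stationary at `stat`, so the optimal `α` is the larger of `cross` and `stat`, cut
off at `lamY` (`isLeast_cross`, `isLeast_max`, `isLeast_lamY`).

For the asymptotics everything is a function of `e = 1 / L`. The point `cross` solves a quadratic
equation whose leading coefficient is of order `e` and whose linear coefficient tends to `covY *
(gap - excess)`, a multiple of `Dth0 - D`. Hence `cross` is bounded below `Dth0`, of order `√L` at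
`Dth0` and of order `L` above it. If `covX > 0`, then `stat` stays bounded, so it can matter only
below `Dth0`. There the limits are ordered by comparing `excess * (gap - excess)` with `ξ² gap²`.
The former never exceeds `gap² / 4`, whence the threshold `ξ = 1/2`; for smaller `ξ` equality holds
at `Dth1` and `Dth2`. If `covX = 0`, then `stat` outgrows `lamY` and the optimum is at `α = lamY`.
If `covY = 0`, the program is solved exactly by `α = β = δ`. -/

/-- The conditions on the parameters under which the lower bound is studied. -/
structure Admissible (p : SymGauss) : Prop where
  varX_pos : 0 < p.varX
  varZ_nonneg : 0 ≤ p.varZ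
  rhoX_mem : p.rhoX ∈ Set.Icc (0 : ℝ) 1
  rhoZ_mem : p.rhoZ ∈ Set.Icc (0 : ℝ) 1
  gamY_pos : 0 < p.gamY

variable {p : SymGauss}

/-- The covariance of two distinct coordinates of `X`. -/
def covX (p : SymGauss) : ℝ := p.rhoX * p.varX

/-- The slope of the distortion constraint in `α`. -/
def slopeA (p : SymGauss) (L : ℕ) : ℝ := p.lamX L ^ 2 * (p.lamY L ^ 2)⁻¹

/-- The slope of the distortion constraint in `β`. -/
def slopeB (p : SymGauss) (L : ℕ) : ℝ := ((L : ℝ) - 1) * (p.gamX ^ 2 * (p.gamY ^ 2)⁻¹)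

/-- The constant term of the distortion constraint. -/
def budget (p : SymGauss) (L : ℕ) (D : ℝ) : ℝ :=
  L * D - (p.lamX L - p.lamX L ^ 2 * (p.lamY L)⁻¹)
    - ((L : ℝ) - 1) * (p.gamX - p.gamX ^ 2 * p.gamY⁻¹)

/-- The largest `δ` compatible with `α`, as a fraction without inverses. -/
def cap (p : SymGauss) (L : ℕ) (α : ℝ) : ℝ :=
  p.lamY L * p.gamY * α / ((p.lamY L - p.gamY) * α + p.lamY L * p.gamY)

/-! ### Eigenvalues and the curve `δ = cap α` -/

namespace Admissible

variable (hp : p.Admissible)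
include hp

lemma varY_pos : 0 < p.varY := add_pos_of_pos_of_nonneg hp.varX_pos hp.varZ_nonneg

lemma covX_nonneg : 0 ≤ p.covX := mul_nonneg hp.rhoX_mem.1 hp.varX_pos.le

lemma covY_nonneg : 0 ≤ p.covY :=
  add_nonneg hp.covX_nonneg (mul_nonneg hp.rhoZ_mem.1 hp.varZ_nonneg)

lemma gamX_nonneg : 0 ≤ p.gamX := mul_nonneg (by linarith [hp.rhoX_mem.2]) hp.varX_pos.le

lemma gamY_eq : p.gamY = p.varY - p.covY := by
  have := hp.varY_pos.ne'
  unfold gamY rhoY; field_simp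

lemma lamY_eq (L : ℕ) : p.lamY L = p.gamY + L * p.covY := by
  have := hp.varY_pos.ne'
  unfold lamY gamY rhoY; field_simp; ring

omit hp in
lemma _root_.SymGauss.lamX_eq (L : ℕ) : p.lamX L = p.gamX + L * p.covX := by
  unfold lamX gamX covX; ring

omit hp in
lemma _root_.SymGauss.varX_eq : p.varX = p.covX + p.gamX := by
  unfold gamX covX; ring

lemma gamZ_eq : p.gamZ = p.gamY - p.gamX := by
  rw [hp.gamY_eq]; unfold gamZ gamX varY covY; ring

lemma gamY_le_lamY (L : ℕ) : p.gamY ≤ p.lamY L := by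
  rw [hp.lamY_eq]
  have := mul_nonneg (Nat.cast_nonneg (α := ℝ) L) hp.covY_nonneg
  linarith

lemma lamY_pos (L : ℕ) : 0 < p.lamY L := hp.gamY_pos.trans_le (hp.gamY_le_lamY L)

lemma lamW_eq (L : ℕ) : p.lamW L = p.gamY := min_eq_right (hp.gamY_le_lamY L)

lemma slopeB_nonneg {L : ℕ} (hL : 1 ≤ L) : 0 ≤ p.slopeB L := by
  have : (1 : ℝ) ≤ L := by exact_mod_cast hL
  unfold slopeB
  have := hp.gamY_pos
  exact mul_nonneg (by linarith) (by positivity)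

lemma slopeA_pos {L : ℕ} (hL : 1 ≤ L) : 0 < p.slopeA L := by
  have : (1 : ℝ) ≤ L := by exact_mod_cast hL
  have h1 : 0 < p.lamX L := by
    have := hp.varX_pos
    have := hp.rhoX_mem.1
    unfold lamX
    have : 0 ≤ ((L : ℝ) - 1) * p.rhoX := mul_nonneg (by linarith) this
    positivity
  have := hp.lamY_pos L
  unfold slopeA; positivity

lemma denom_pos (L : ℕ) {α : ℝ} (hα : 0 < α) :
    0 < (p.lamY L - p.gamY) * α + p.lamY L * p.gamY := by
  have h1 := hp.gamY_le_lamY L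
  have h2 := hp.lamY_pos L
  have h3 := hp.gamY_pos
  have : 0 ≤ (p.lamY L - p.gamY) * α := mul_nonneg (by linarith) hα.le
  positivity

lemma cap_eq (L : ℕ) {α : ℝ} (hα : 0 < α) :
    (α⁻¹ + p.gamY⁻¹ - (p.lamY L)⁻¹)⁻¹ = p.cap L α := by
  have h1 := hp.denom_pos L hα
  have h2 := hp.lamY_pos L
  have h3 := hp.gamY_pos
  have : α⁻¹ + p.gamY⁻¹ - (p.lamY L)⁻¹ =
      ((p.lamY L - p.gamY) * α + p.lamY L * p.gamY) / (p.lamY L * p.gamY * α) := by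
    field_simp; ring
  rw [this, inv_div]; rfl

lemma cap_pos (L : ℕ) {α : ℝ} (hα : 0 < α) : 0 < p.cap L α := by
  have h1 := hp.denom_pos L hα
  have h2 := hp.lamY_pos L
  have h3 := hp.gamY_pos
  unfold cap; positivity

lemma cap_lamY (L : ℕ) : p.cap L (p.lamY L) = p.gamY := by
  have h1 := hp.denom_pos L (hp.lamY_pos L)
  have h2 := hp.lamY_pos L
  unfold cap
  rw [div_eq_iff h1.ne']; ring

lemma cap_sub_cap (L : ℕ) {α α₁ : ℝ} (hα : 0 < α) (hα₁ : 0 < α₁) :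
    p.cap L α - p.cap L α₁ = (p.lamY L * p.gamY) ^ 2 * (α - α₁) /
      (((p.lamY L - p.gamY) * α + p.lamY L * p.gamY) *
        ((p.lamY L - p.gamY) * α₁ + p.lamY L * p.gamY)) := by
  have h1 := (hp.denom_pos L hα).ne'
  have h2 := (hp.denom_pos L hα₁).ne'
  unfold cap
  rw [div_sub_div _ _ h1 h2]
  congr 1; ring

lemma cap_mono (L : ℕ) {α α₁ : ℝ} (hα₁ : 0 < α₁) (h : α₁ ≤ α) : p.cap L α₁ ≤ p.cap L α := by
  have hα := hα₁.trans_le h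
  rw [← sub_nonneg, hp.cap_sub_cap L hα hα₁]
  have h1 := hp.denom_pos L hα
  have h2 := hp.denom_pos L hα₁
  have : 0 ≤ α - α₁ := by linarith
  positivity

/-- Concavity of a Möbius function: tangent minus curve is a nonnegative multiple of `(lamY - gamY)
* (α - α₁) ^ 2`. This linearises the constraint `δ ≤ cap α` in the optimality proof. -/
lemma cap_le_tangent (L : ℕ) {α α₁ : ℝ} (hα : 0 < α) (hα₁ : 0 < α₁) :
    p.cap L α - p.cap L α₁ ≤ (p.lamY L * p.gamY) ^ 2 /
      ((p.lamY L - p.gamY) * α₁ + p.lamY L * p.gamY) ^ 2 * (α - α₁) := by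
  rw [hp.cap_sub_cap L hα hα₁, ← sub_nonneg]
  have h1 := hp.denom_pos L hα
  have h2 := hp.denom_pos L hα₁
  have h0 := hp.gamY_le_lamY L
  have : (p.lamY L * p.gamY) ^ 2 / ((p.lamY L - p.gamY) * α₁ + p.lamY L * p.gamY) ^ 2 * (α - α₁)
      - (p.lamY L * p.gamY) ^ 2 * (α - α₁) /
      (((p.lamY L - p.gamY) * α + p.lamY L * p.gamY) *
        ((p.lamY L - p.gamY) * α₁ + p.lamY L * p.gamY))
      = (p.lamY L * p.gamY) ^ 2 * (p.lamY L - p.gamY) * (α - α₁) ^ 2 /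
        (((p.lamY L - p.gamY) * α + p.lamY L * p.gamY) *
        ((p.lamY L - p.gamY) * α₁ + p.lamY L * p.gamY) ^ 2) := by
    have h1' := h1.ne'
    have h2' := h2.ne'
    generalize hu : (p.lamY L - p.gamY) * α + p.lamY L * p.gamY = u at *
    generalize hv : (p.lamY L - p.gamY) * α₁ + p.lamY L * p.gamY = v at *
    have : u - v = (p.lamY L - p.gamY) * (α - α₁) := by rw [← hu, ← hv]; ring
    field_simp
    linear_combination (p.lamY L ^ 2 * p.gamY ^ 2 * (α - α₁)) * this
  rw [this]
  have : 0 ≤ p.lamY L - p.gamY := by linarith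
  positivity

/-! ### Reduction to two variables and sufficient optimality conditions -/

lemma omega_eq (L : ℕ) (α β δ : ℝ) : p.Omega L α β δ =
    1 / 2 * Real.log (p.lamY L ^ 2 / ((p.lamY L - p.gamY) * α + p.lamY L * p.gamY))
      + (L : ℝ) / 2 * Real.log (p.gamY / δ) := by
  have h := hp.gamY_pos.ne'
  have : p.gamY ^ 2 / ((p.gamY - p.gamY) * β + p.gamY * p.gamY) = 1 := by
    rw [div_eq_one_iff_eq] <;> [ring; (ring_nf; positivity)]
  rw [Omega, hp.lamW_eq, this, Real.log_one, mul_zero, add_zero]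

lemma feasible_iff (L : ℕ) {D α β : ℝ} : p.Feasible L D α β β ↔
    0 < α ∧ α ≤ p.lamY L ∧ 0 < β ∧ β ≤ p.cap L α ∧
      p.slopeA L * α + p.slopeB L * β ≤ p.budget L D := by
  constructor
  · rintro ⟨h1, h2, h3, h4, h5, h6, h7, h8⟩
    rw [hp.lamW_eq, hp.cap_eq L h1] at h6
    refine ⟨h1, h2, h3, h6, ?_⟩
    unfold slopeA slopeB budget; linarith
  · rintro ⟨h1, h2, h3, h4, h5⟩
    refine ⟨h1, h2, h3, ?_, h3, ?_, ?_, ?_⟩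
    · exact h4.trans ((hp.cap_mono L h1 h2).trans_eq (hp.cap_lamY L))
    · rwa [hp.lamW_eq, hp.cap_eq L h1]
    · rw [hp.lamW_eq]; simp
    · unfold slopeA slopeB budget at h5; linarith

/-- Since `β` no longer enters the objective and its distortion coefficient is nonnegative, lowering
it to `δ` costs nothing. -/
lemma feasible_diag {L : ℕ} (hL : 1 ≤ L) {D α β δ : ℝ} (h : p.Feasible L D α β δ) :
    p.Feasible L D α δ δ := by
  have hδ : δ ≤ β := by simpa [hp.lamW_eq] using h.delta_le_beta
  have hmul := mul_le_mul_of_nonneg_left hδ (hp.slopeB_nonneg hL)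
  have := h.distortion
  have h6 := h.delta_le_alpha
  rw [hp.lamW_eq, hp.cap_eq L h.alpha_pos] at h6
  refine (hp.feasible_iff L).2 ⟨h.alpha_pos, h.alpha_le, h.delta_pos, h6, ?_⟩
  unfold slopeA slopeB budget at *; linarith

/-- First-order sufficient condition for optimality: the objective is convex in `(α, δ)`. -/
lemma isLeast_of_gradient {L : ℕ} (hL : 1 ≤ L) {D α₁ β₁ : ℝ} (h₁ : p.Feasible L D α₁ β₁ β₁)
    (hgrad : ∀ α β, p.Feasible L D α β β →
      (p.lamY L - p.gamY) / ((p.lamY L - p.gamY) * α₁ + p.lamY L * p.gamY) * (α - α₁)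
        + L / β₁ * (β - β₁) ≤ 0) :
    IsLeast (p.values L D) (p.Omega L α₁ β₁ β₁) := by
  refine ⟨⟨α₁, β₁, β₁, h₁, rfl⟩, ?_⟩
  rintro _ ⟨α, β, δ, h, rfl⟩
  have h' := hp.feasible_diag hL h
  have hg := hgrad α δ h'
  have hl := hp.lamY_pos L
  have hgam := hp.gamY_pos
  have hu := hp.denom_pos L h.alpha_pos
  have hu₁ := hp.denom_pos L h₁.alpha_pos
  have hδ := h.delta_pos
  have hβ₁ := h₁.beta_pos
  rw [hp.omega_eq, hp.omega_eq, Real.log_div (by positivity) hu.ne',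
    Real.log_div (by positivity) hu₁.ne', Real.log_div hgam.ne' hδ.ne',
    Real.log_div hgam.ne' hβ₁.ne']
  set u := (p.lamY L - p.gamY) * α + p.lamY L * p.gamY with hu_def
  set u₁ := (p.lamY L - p.gamY) * α₁ + p.lamY L * p.gamY with hu₁_def
  -- Convexity enters only through the tangent bound `log t ≤ t - 1`, at `t = u / u₁` here and at `t
  -- = δ / β₁` below.
  have e1 : Real.log u - Real.log u₁ ≤ (p.lamY L - p.gamY) / u₁ * (α - α₁) := by
    rw [← Real.log_div hu.ne' hu₁.ne']
    refine (Real.log_le_sub_one_of_pos (by positivity)).trans_eq ?_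
    field_simp; rw [hu_def, hu₁_def]; ring
  have e2 : Real.log δ - Real.log β₁ ≤ 1 / β₁ * (δ - β₁) := by
    rw [← Real.log_div hδ.ne' hβ₁.ne']
    refine (Real.log_le_sub_one_of_pos (by positivity)).trans_eq ?_
    field_simp
  have e3 := mul_le_mul_of_nonneg_left e2 (Nat.cast_nonneg (α := ℝ) L)
  have e4 : (L : ℝ) * (1 / β₁ * (δ - β₁)) = L / β₁ * (δ - β₁) := by ring
  linarith

/-- If both constraints on `β` are active and the multiplier of `β ≤ cap α` is nonnegative, the
point is optimal. -/
lemma isLeast_of_crossing {L : ℕ} (hL : 1 ≤ L) {D α₁ : ℝ} (hα₁ : 0 < α₁) (hα₁' : α₁ ≤ p.lamY L)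
    (hcross : p.slopeA L * α₁ + p.slopeB L * p.cap L α₁ = p.budget L D)
    (hmult : p.slopeB L * p.cap L α₁ * (p.lamY L - p.gamY) ≤
      L * p.slopeA L * ((p.lamY L - p.gamY) * α₁ + p.lamY L * p.gamY)) :
    IsLeast (p.values L D) (p.Omega L α₁ (p.cap L α₁) (p.cap L α₁)) := by
  have hβ₁ := hp.cap_pos L hα₁
  refine hp.isLeast_of_gradient hL
    ((hp.feasible_iff L).2 ⟨hα₁, hα₁', hβ₁, le_rfl, hcross.le⟩) fun α β h => ?_
  obtain ⟨hα, hα', hβ, hcap, hdist⟩ := (hp.feasible_iff L).1 h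
  have hA := hp.slopeA_pos hL
  have hB := hp.slopeB_nonneg hL
  have htan := hp.cap_le_tangent L hα hα₁
  have hu₁ := hp.denom_pos L hα₁
  have hlg := hp.gamY_le_lamY L
  set u₁ := (p.lamY L - p.gamY) * α₁ + p.lamY L * p.gamY with hu₁_def
  set t := (p.lamY L * p.gamY) ^ 2 / u₁ ^ 2 with ht
  set a := p.slopeA L
  set b := p.slopeB L
  set β₁ := p.cap L α₁
  have ht0 : 0 ≤ t := by positivity
  set P := (p.lamY L - p.gamY) / u₁ with hP
  set Q := (L : ℝ) / β₁ with hQ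
  have hP0 : 0 ≤ P := div_nonneg (by linarith) hu₁.le
  have hQ0 : 0 ≤ Q := by positivity
  have hν : b * P ≤ Q * a := by
    rw [hP, hQ, mul_div_assoc', div_mul_eq_mul_div, div_le_div_iff₀ hu₁ hβ₁]
    linarith
  have hd : a * (α - α₁) + b * (β - β₁) ≤ 0 := by linarith
  have hc : (β - β₁) - t * (α - α₁) ≤ 0 := by linarith
  have hden : 0 < a + b * t := by positivity
  -- The gradient is a combination of the two active constraint normals; `P + Q * t` and `Q * a - b
  -- * P` are their multipliers up to the common factor `a + b * t`. No division by `b` occurs, so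
  -- `b = 0` is allowed.
  have key : (a + b * t) * (P * (α - α₁) + Q * (β - β₁)) =
      (P + Q * t) * (a * (α - α₁) + b * (β - β₁))
        + (Q * a - b * P) * ((β - β₁) - t * (α - α₁)) := by ring
  have h1 := mul_nonpos_of_nonneg_of_nonpos (by positivity : 0 ≤ P + Q * t) hd
  have h2 := mul_nonpos_of_nonneg_of_nonpos (sub_nonneg.2 hν) hc
  exact nonpos_of_mul_nonpos_right (by rw [key]; linarith) hden

/-- If only the distortion constraint, and possibly `α ≤ lamY`, is active, with nonnegative
multipliers, the point is optimal. -/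
lemma isLeast_of_distortion {L : ℕ} (hL : 1 ≤ L) {D α₁ β₁ : ℝ} (h₁ : p.Feasible L D α₁ β₁ β₁)
    (hB : 0 < p.slopeB L)
    (hdist₁ : p.slopeA L * α₁ + p.slopeB L * β₁ = p.budget L D)
    (hmult : L * p.slopeA L * ((p.lamY L - p.gamY) * α₁ + p.lamY L * p.gamY) ≤
      p.slopeB L * β₁ * (p.lamY L - p.gamY))
    (hactive : α₁ = p.lamY L ∨
      L * p.slopeA L * ((p.lamY L - p.gamY) * α₁ + p.lamY L * p.gamY) =
      p.slopeB L * β₁ * (p.lamY L - p.gamY)) :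
    IsLeast (p.values L D) (p.Omega L α₁ β₁ β₁) := by
  refine hp.isLeast_of_gradient hL h₁ fun α β h => ?_
  obtain ⟨hα, hα', hβ, hcap, hdist⟩ := (hp.feasible_iff L).1 h
  have hu₁ := hp.denom_pos L h₁.alpha_pos
  have hβ₁ := h₁.beta_pos
  set u₁ := (p.lamY L - p.gamY) * α₁ + p.lamY L * p.gamY with hu₁_def
  set a := p.slopeA L
  set b := p.slopeB L
  have hd : a * (α - α₁) + b * (β - β₁) ≤ 0 := by linarith
  -- Here the multipliers, up to positive factors, belong to the distortion constraint and to `α ≤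
  -- lamY`; the second one vanishes at an interior stationary point.
  have key : b * ((p.lamY L - p.gamY) / u₁ * (α - α₁) + L / β₁ * (β - β₁)) =
      L / β₁ * (a * (α - α₁) + b * (β - β₁))
      + (b * β₁ * (p.lamY L - p.gamY) - L * a * u₁) * (α - α₁) / (u₁ * β₁) := by
    field_simp; ring
  refine nonpos_of_mul_nonpos_right ?_ hB
  rw [key]
  have h1 := mul_nonpos_of_nonneg_of_nonpos (by positivity : 0 ≤ (L : ℝ) / β₁) hd
  have h2 : (b * β₁ * (p.lamY L - p.gamY) - L * a * u₁) * (α - α₁) ≤ 0 := by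
    rcases hactive with h | h
    · exact mul_nonpos_of_nonneg_of_nonpos (by linarith) (by linarith)
    · rw [h]; simp
  have h3 := div_nonpos_of_nonpos_of_nonneg h2 (by positivity : 0 ≤ u₁ * β₁)
  linarith

end Admissible

lemma lowerR_eq_of_isLeast {L : ℕ} {D m : ℝ} (h : IsLeast (p.values L D) m) :
    p.lowerR L D = m := h.csInf_eq

/-! ### The candidate optima as functions of `1 / L` -/

/-- The distance of the distortion from its smallest limiting value. -/
def excess (p : SymGauss) (D : ℝ) : ℝ := D - p.dminInf

/-- The amount `gamX² / gamY` by which `Dth0` exceeds `dminInf`. -/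
def gap (p : SymGauss) : ℝ := p.gamX ^ 2 / p.gamY

/-- The constant part of `lamX - (covX / covY) * lamY`. -/
def skew (p : SymGauss) : ℝ := p.gamX - p.covX * p.gamY / p.covY

/-- `lamY / L` as a function of `1 / L`. -/
def lev (p : SymGauss) (e : ℝ) : ℝ := p.covY + p.gamY * e

/-- The slope of the distortion constraint in `α` as a function of `1 / L`. -/
def slope (p : SymGauss) (e : ℝ) : ℝ := (p.covX / p.covY + p.skew * e / p.lev e) ^ 2

/-- The variable part of the linear coefficient of the quadratic equation for the crossing point. -/
def quadB1 (p : SymGauss) (e : ℝ) : ℝ :=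
  p.slope e * p.gamY * p.lev e + p.gap * (p.gamY - p.lev e)
    + p.skew ^ 2 * p.covY ^ 2 / (p.gamY * p.lev e)

/-- The linear coefficient of the quadratic equation for the crossing point. -/
def quadB (p : SymGauss) (D e : ℝ) : ℝ := p.covY * (p.gap - p.excess D) + e * p.quadB1 e

/-- Minus the constant coefficient of the quadratic equation for the crossing point. -/
def quadC (p : SymGauss) (D e : ℝ) : ℝ :=
  p.excess D * p.gamY * p.lev e - p.skew ^ 2 * p.covY * e

/-- The discriminant of the quadratic equation for the crossing point. -/
def quadDisc (p : SymGauss) (D e : ℝ) : ℝ :=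
  p.quadB D e ^ 2 + 4 * (e * p.slope e * p.covY * p.quadC D e)

/-- The positive `α` at which both constraints on `β` are active, as a function of `1 / L`. -/
def cross (p : SymGauss) (D e : ℝ) : ℝ :=
  2 * p.quadC D e / (p.quadB D e + √(p.quadDisc D e))

/-- The stationary point of the objective along the line where the distortion constraint is
active. -/
def stat (p : SymGauss) (L : ℕ) (D : ℝ) : ℝ :=
  (p.budget L D / p.slopeA L - p.lamY L * p.gamY / p.covY) / (L + 1)

namespace Admissible

variable (hp : p.Admissible)
include hp

lemma lev_pos (hs : 0 < p.covY) {e : ℝ} (he : 0 ≤ e) : 0 < p.lev e := by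
  have := hp.gamY_pos
  unfold lev; positivity

lemma lamY_eq_lev {L : ℕ} (hL : 1 ≤ L) : p.lamY L = L * p.lev (L : ℝ)⁻¹ := by
  have : (L : ℝ) ≠ 0 := by positivity
  rw [hp.lamY_eq, lev]; field_simp; ring

/-- Both eigenvalues are affine in `L`; eliminating `L` makes `lamX / lamY` a constant plus a term
of order `1 / L`. -/
lemma lamX_eq_lev (hs : 0 < p.covY) (L : ℕ) :
    p.lamX L = p.covX / p.covY * p.lamY L + p.skew := by
  rw [hp.lamY_eq, lamX_eq, skew]; field_simp; ring

lemma slopeA_eq (hs : 0 < p.covY) {L : ℕ} (hL : 1 ≤ L) :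
    p.slopeA L = p.slope (L : ℝ)⁻¹ := by
  have h0 : (L : ℝ) ≠ 0 := by positivity
  have h1 := (hp.lev_pos hs (e := (L : ℝ)⁻¹) (by positivity)).ne'
  rw [slopeA, hp.lamX_eq_lev hs L, hp.lamY_eq_lev hL, slope]
  generalize p.lev (L : ℝ)⁻¹ = l at *
  field_simp

omit hp in
lemma _root_.SymGauss.slopeB_eq (p : SymGauss) (L : ℕ) :
    p.slopeB L = (L - 1) * (p.gap / p.gamY) := by
  unfold slopeB gap
  simp only [div_eq_mul_inv, mul_inv, pow_two]; ring

lemma dminInf_eq (hs : 0 < p.covY) :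
    p.dminInf = p.covX - p.covX ^ 2 / p.covY + p.gamX - p.gap := by
  have hg := hp.gamY_pos
  have e1 : p.rhoX * p.rhoZ * p.varX * p.varZ = p.covX * (p.covY - p.covX) := by
    unfold covY covX; ring
  rw [dminInf, if_neg hs.ne', e1, hp.gamZ_eq, gap]
  field_simp; ring

lemma Dth0_eq (hs : 0 < p.covY) : p.Dth0 = p.dminInf + p.gap := by
  have e1 : p.rhoX * p.rhoZ * p.varX * p.varZ = p.covX * (p.covY - p.covX) := by
    unfold covY covX; ring
  rw [hp.dminInf_eq hs, Dth0, e1]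
  field_simp; ring

lemma budget_eq (hs : 0 < p.covY) {L : ℕ} (hL : 1 ≤ L) (D : ℝ) :
    p.budget L D =
      L * (p.excess D - p.skew ^ 2 * p.covY * (L : ℝ)⁻¹ / (p.gamY * p.lev (L : ℝ)⁻¹)) := by
  have hg := hp.gamY_pos
  have h0 : (L : ℝ) ≠ 0 := by positivity
  have hl := (hp.lamY_pos L).ne'
  have e0 : p.lev (L : ℝ)⁻¹ = p.lamY L / L := by
    rw [hp.lamY_eq_lev hL]; field_simp
  have e1 : (L : ℝ) = (p.lamY L - p.gamY) / p.covY := by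
    rw [hp.lamY_eq]; field_simp; ring
  rw [budget, hp.lamX_eq_lev hs L, excess, hp.dminInf_eq hs, e0, gap, skew]
  generalize p.lamY L = l at *
  field_simp
  rw [e1]
  field_simp
  ring

/-- The point `(lamY, gamY)` has rate zero and distortion `varX` per coordinate, so it overshoots
the budget by `L * (varX - D)`. -/
lemma budget_slack (L : ℕ) (D : ℝ) :
    p.slopeA L * p.lamY L + p.slopeB L * p.gamY = p.budget L D + L * (p.varX - D) := by
  have hg := hp.gamY_pos
  have hl := (hp.lamY_pos L).ne'
  rw [slopeA, slopeB, budget, varX_eq]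
  have := p.lamX_eq L
  field_simp
  rw [this]; ring

lemma slope_pos (hs : 0 < p.covY) {L : ℕ} (hL : 1 ≤ L) : 0 < p.slope (L : ℝ)⁻¹ := by
  rw [← hp.slopeA_eq hs hL]; exact hp.slopeA_pos hL

/-- The leading coefficient and `quadC` are positive. Hence both `√quadDisc + quadB` and `√quadDisc
- quadB` are positive, whatever the sign of `quadB`. -/
lemma quadDisc_gt (hs : 0 < p.covY) {L : ℕ} (hL : 1 ≤ L) {D : ℝ} (hC : 0 < p.quadC D (L : ℝ)⁻¹) :
    |p.quadB D (L : ℝ)⁻¹| < √(p.quadDisc D (L : ℝ)⁻¹) := by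
  have := hp.slope_pos hs hL
  have h0 : (0 : ℝ) < L := by positivity
  rw [← Real.sqrt_sq_eq_abs]
  refine Real.sqrt_lt_sqrt (sq_nonneg _) ?_
  unfold quadDisc
  have : 0 < 4 * ((L : ℝ)⁻¹ * p.slope (L : ℝ)⁻¹ * p.covY * p.quadC D (L : ℝ)⁻¹) := by positivity
  linarith

lemma cross_denom_pos (hs : 0 < p.covY) {L : ℕ} (hL : 1 ≤ L) {D : ℝ}
    (hC : 0 < p.quadC D (L : ℝ)⁻¹) :
    0 < p.quadB D (L : ℝ)⁻¹ + √(p.quadDisc D (L : ℝ)⁻¹) := by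
  have := hp.quadDisc_gt hs hL hC
  have := neg_abs_le (p.quadB D (L : ℝ)⁻¹)
  linarith

lemma cross_pos (hs : 0 < p.covY) {L : ℕ} (hL : 1 ≤ L) {D : ℝ} (hC : 0 < p.quadC D (L : ℝ)⁻¹) :
    0 < p.cross D (L : ℝ)⁻¹ :=
  div_pos (by positivity) (hp.cross_denom_pos hs hL hC)

/-- The rationalised root `2C / (B + √Δ)` never divides by the leading coefficient, which tends to
zero with `1 / L`. -/
lemma cross_quadratic (hs : 0 < p.covY) {L : ℕ} (hL : 1 ≤ L) {D : ℝ}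
    (hC : 0 < p.quadC D (L : ℝ)⁻¹) :
    (L : ℝ)⁻¹ * p.slope (L : ℝ)⁻¹ * p.covY * p.cross D (L : ℝ)⁻¹ ^ 2
      + p.quadB D (L : ℝ)⁻¹ * p.cross D (L : ℝ)⁻¹ = p.quadC D (L : ℝ)⁻¹ := by
  have h1 := (hp.cross_denom_pos hs hL hC).ne'
  have hsq : √(p.quadDisc D (L : ℝ)⁻¹) ^ 2 = p.quadDisc D (L : ℝ)⁻¹ := by
    refine Real.sq_sqrt ?_
    have := hp.slope_pos hs hL
    unfold quadDisc; positivity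
  unfold cross
  generalize √(p.quadDisc D (L : ℝ)⁻¹) = R at *
  rw [quadDisc] at hsq
  generalize p.quadC D (L : ℝ)⁻¹ = C at *
  generalize p.quadB D (L : ℝ)⁻¹ = B at *
  generalize (L : ℝ)⁻¹ * p.slope (L : ℝ)⁻¹ * p.covY = A at *
  field_simp
  linear_combination (-1) * hsq

/-- Multiplying the crossing equation by the denominator `covY * α + lev * gamY` of `cap` turns it
into the quadratic solved by `cross`. -/
lemma crossing_eq (hs : 0 < p.covY) {L : ℕ} (hL : 1 ≤ L) {D : ℝ} (hC : 0 < p.quadC D (L : ℝ)⁻¹) :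
    p.slopeA L * p.cross D (L : ℝ)⁻¹ + p.slopeB L * p.cap L (p.cross D (L : ℝ)⁻¹) =
      p.budget L D := by
  have hq := hp.cross_quadratic hs hL hC
  have hg := hp.gamY_pos
  have h0 : (L : ℝ) ≠ 0 := by positivity
  have h1 := (hp.lev_pos hs (e := (L : ℝ)⁻¹) (by positivity)).ne'
  have hu := (hp.denom_pos L (hp.cross_pos hs hL hC)).ne'
  rw [hp.budget_eq hs hL, slopeB_eq, hp.slopeA_eq hs hL, cap]
  have hlev : p.lev (L : ℝ)⁻¹ = p.covY + p.gamY * (L : ℝ)⁻¹ := rfl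
  have e0 : p.lamY L - p.gamY = L * p.covY := by rw [hp.lamY_eq]; ring
  rw [e0] at hu ⊢
  rw [hp.lamY_eq_lev hL] at hu ⊢
  rw [quadB, quadB1, quadC] at hq
  generalize p.cross D (L : ℝ)⁻¹ = α at *
  generalize p.slope (L : ℝ)⁻¹ = a at *
  generalize p.lev (L : ℝ)⁻¹ = l at *
  have hu' : p.covY * α + l * p.gamY ≠ 0 := fun h => hu (by linear_combination (L : ℝ) * h)
  have e2 : (L : ℝ) * l * p.gamY * α / (L * p.covY * α + L * l * p.gamY) =
      l * p.gamY * α / (p.covY * α + l * p.gamY) := by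
    rw [show (L : ℝ) * l * p.gamY * α = L * (l * p.gamY * α) by ring,
      show (L : ℝ) * p.covY * α + L * l * p.gamY = L * (p.covY * α + l * p.gamY) by ring,
      mul_div_mul_left _ _ h0]
  have hLe : (L : ℝ) * (L : ℝ)⁻¹ = 1 := mul_inv_cancel₀ h0
  rw [e2]
  generalize (L : ℝ)⁻¹ = e at *
  generalize (L : ℝ) = N at *
  have e3 : p.skew ^ 2 * p.covY ^ 2 / (p.gamY * l) = p.covY * (p.skew ^ 2 * p.covY / (p.gamY * l)) := by
    ring
  have e4 : p.skew ^ 2 * p.covY * e / (p.gamY * l) = e * (p.skew ^ 2 * p.covY / (p.gamY * l)) := by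
    ring
  have e5 : p.skew ^ 2 * p.covY / (p.gamY * l) * (l * p.gamY) = p.skew ^ 2 * p.covY := by
    field_simp
  rw [e3] at hq
  rw [e4]
  generalize p.skew ^ 2 * p.covY / (p.gamY * l) = v at *
  have e6 : (N - 1) * (p.gap / p.gamY) * (l * p.gamY * α / (p.covY * α + l * p.gamY)) =
      (N - 1) * p.gap * l * α / (p.covY * α + l * p.gamY) := by
    field_simp
  rw [e6, ← eq_sub_iff_add_eq', div_eq_iff hu']
  -- `N` and `e` have been made independent variables, so `N * e = 1` has to be fed in through
  -- `hLe`.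
  linear_combination N * hq + e5 + p.gap * α * N * hlev + (v * (p.covY * α + l * p.gamY)
    - (a * α ^ 2 * p.covY + (a * p.gamY * l + p.gap * (p.gamY - l) + p.covY * v) * α
      + p.skew ^ 2 * p.covY) + p.gap * α * p.gamY) * hLe

/-! ### Locating the minimiser -/

lemma slopeA_mul_add_le {L : ℕ} (hL : 1 ≤ L) {α₁ α₂ : ℝ} (h₁ : 0 < α₁) (h : α₁ < α₂) :
    p.slopeA L * α₁ + p.slopeB L * p.cap L α₁ < p.slopeA L * α₂ + p.slopeB L * p.cap L α₂ := by
  have h1 := mul_lt_mul_of_pos_left h (hp.slopeA_pos hL)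
  have h2 := mul_le_mul_of_nonneg_left (hp.cap_mono L h₁ h.le) (hp.slopeB_nonneg hL)
  linarith

lemma cross_lt_lamY (hs : 0 < p.covY) {L : ℕ} (hL : 1 ≤ L) {D : ℝ} (hD : D < p.varX)
    (hC : 0 < p.quadC D (L : ℝ)⁻¹) : p.cross D (L : ℝ)⁻¹ ≤ p.lamY L := by
  by_contra! h
  have h1 := hp.slopeA_mul_add_le hL (hp.lamY_pos L) h
  rw [hp.crossing_eq hs hL hC, hp.cap_lamY, hp.budget_slack] at h1
  have : 0 < (L : ℝ) * (p.varX - D) := mul_pos (by positivity) (by linarith)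
  linarith

/-- The right side is the sign condition on the derivative of the objective along the distortion
line, with denominators cleared. With `slopeB * β` for the remaining budget it is the multiplier
condition of `isLeast_of_crossing`. -/
lemma stat_le_iff (hs : 0 < p.covY) {L : ℕ} (hL : 1 ≤ L) {D α : ℝ} :
    p.stat L D ≤ α ↔ (p.budget L D - p.slopeA L * α) * (p.lamY L - p.gamY) ≤
      L * p.slopeA L * ((p.lamY L - p.gamY) * α + p.lamY L * p.gamY) := by
  have hA := hp.slopeA_pos hL
  have h0 : (0 : ℝ) < L := by positivity
  have e0 : p.lamY L - p.gamY = L * p.covY := by rw [hp.lamY_eq]; ring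
  rw [stat, div_le_iff₀ (by positivity), sub_le_iff_le_add, div_le_iff₀ hA, e0,
    ← mul_le_mul_iff_right₀ (mul_pos h0 hs)]
  have : L * p.covY * ((α * (L + 1) + p.lamY L * p.gamY / p.covY) * p.slopeA L) =
     L * p.slopeA L * (L * p.covY * α + p.lamY L * p.gamY) + L * p.covY * α * p.slopeA L := by
    field_simp; ring
  rw [this]
  constructor <;> intro h <;> linarith

lemma stat_eq (hs : 0 < p.covY) {L : ℕ} (hL : 1 ≤ L) (D : ℝ) :
    L * p.slopeA L * ((p.lamY L - p.gamY) * p.stat L D + p.lamY L * p.gamY) =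
      (p.budget L D - p.slopeA L * p.stat L D) * (p.lamY L - p.gamY) := by
  have hA := hp.slopeA_pos hL
  have h0 : (0 : ℝ) < L := by positivity
  have e0 : p.lamY L - p.gamY = L * p.covY := by rw [hp.lamY_eq]; ring
  have : p.stat L D * (L + 1) * p.slopeA L * p.covY =
      p.budget L D * p.covY - p.lamY L * p.gamY * p.slopeA L := by
    unfold stat; field_simp
  rw [e0]
  linear_combination (L : ℝ) * this

lemma isLeast_cross (hs : 0 < p.covY) {L : ℕ} (hL : 1 ≤ L) {D : ℝ} (hD : D < p.varX)
    (hC : 0 < p.quadC D (L : ℝ)⁻¹) (hstat : p.stat L D ≤ p.cross D (L : ℝ)⁻¹) :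
    IsLeast (p.values L D) (p.Omega L (p.cross D (L : ℝ)⁻¹)
      (p.cap L (p.cross D (L : ℝ)⁻¹)) (p.cap L (p.cross D (L : ℝ)⁻¹))) := by
  refine hp.isLeast_of_crossing hL (hp.cross_pos hs hL hC) (hp.cross_lt_lamY hs hL hD hC)
    (hp.crossing_eq hs hL hC) ?_
  rw [eq_sub_iff_add_eq'.2 (hp.crossing_eq hs hL hC)]
  exact (hp.stat_le_iff hs hL).1 hstat

/-- The objective along the line where the distortion constraint is active. -/
def _root_.SymGauss.lineValue (p : SymGauss) (L : ℕ) (D α : ℝ) : ℝ :=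
  1 / 2 * Real.log (p.lamY L ^ 2 / ((p.lamY L - p.gamY) * α + p.lamY L * p.gamY))
    + L / 2 * Real.log (p.gamY * p.slopeB L / (p.budget L D - p.slopeA L * α))

lemma omega_eq_lineValue {L : ℕ} {D α β : ℝ} (hB : 0 < p.slopeB L)
    (h : p.slopeA L * α + p.slopeB L * β = p.budget L D) :
    p.Omega L α β β = p.lineValue L D α := by
  rw [hp.omega_eq, lineValue, ← eq_sub_iff_add_eq'.2 h, mul_comm p.gamY,
    mul_div_mul_left _ _ hB.ne']

/-- Along the distortion line `β` falls as `α` grows while `cap` rises, so the admissible `α` start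
at `cross`; convexity then places the minimum at `stat`, or at `cross` if `stat` lies to its left.
-/
lemma isLeast_max (hs : 0 < p.covY) {L : ℕ} (hL : 1 ≤ L) {D : ℝ} (hD : D < p.varX)
    (hC : 0 < p.quadC D (L : ℝ)⁻¹) (hB : 0 < p.slopeB L) (hstat : p.stat L D ≤ p.lamY L) :
    IsLeast (p.values L D) (p.lineValue L D (max (p.cross D (L : ℝ)⁻¹) (p.stat L D))) := by
  rcases le_total (p.stat L D) (p.cross D (L : ℝ)⁻¹) with h | h
  · rw [max_eq_left h, ← hp.omega_eq_lineValue hB (hp.crossing_eq hs hL hC)]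
    exact hp.isLeast_cross hs hL hD hC h
  · rw [max_eq_right h]
    have hcr := hp.cross_pos hs hL hC
    have hst := hcr.trans_le h
    set β := (p.budget L D - p.slopeA L * p.stat L D) / p.slopeB L with hβ
    have hβ' : p.slopeB L * β = p.budget L D - p.slopeA L * p.stat L D := by
      rw [hβ]; field_simp
    have hline : p.slopeA L * p.stat L D + p.slopeB L * β = p.budget L D := by linarith
    rw [← hp.omega_eq_lineValue hB hline]
    have hse := hp.stat_eq hs hL D
    have e0 : p.lamY L - p.gamY = L * p.covY := by rw [hp.lamY_eq]; ring
    have h0 : (0 : ℝ) < L := by positivity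
    have hpos : 0 < p.budget L D - p.slopeA L * p.stat L D := by
      have h1 : 0 < p.lamY L - p.gamY := by rw [e0]; positivity
      have h2 := hp.denom_pos L hst
      have h3 := hp.slopeA_pos hL
      refine pos_of_mul_pos_left (b := p.lamY L - p.gamY) ?_ h1.le
      rw [← hse]; positivity
    refine hp.isLeast_of_distortion hL ((hp.feasible_iff L).2 ⟨hst, hstat, by positivity, ?_,
      hline.le⟩) hB hline ?_ (.inr ?_)
    · have h1 := hp.crossing_eq hs hL hC
      have h2 := mul_le_mul_of_nonneg_left h (hp.slopeA_pos hL).le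
      have h3 := mul_le_mul_of_nonneg_left (hp.cap_mono L hcr h) hB.le
      exact le_of_mul_le_mul_left (by linarith) hB
    · rw [hβ', hse]
    · rw [hβ', hse]

/-- If `stat` is at or beyond `lamY`, the objective still does not increase along the line up to `α
= lamY`, where the range of `α` ends. -/
lemma isLeast_lamY (hs : 0 < p.covY) {L : ℕ} (hL : 1 ≤ L) {D : ℝ} (hD : D < p.varX)
    (hB : 0 < p.slopeB L) (hpos : 0 < p.budget L D - p.slopeA L * p.lamY L)
    (hstat : p.lamY L ≤ p.stat L D) :
    IsLeast (p.values L D) (p.lineValue L D (p.lamY L)) := by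
  set β := (p.budget L D - p.slopeA L * p.lamY L) / p.slopeB L with hβ
  have hβ' : p.slopeB L * β = p.budget L D - p.slopeA L * p.lamY L := by
    rw [hβ]; field_simp
  have hline : p.slopeA L * p.lamY L + p.slopeB L * β = p.budget L D := by linarith
  have h0 : (0 : ℝ) < L := by positivity
  rw [← hp.omega_eq_lineValue hB hline]
  refine hp.isLeast_of_distortion hL ((hp.feasible_iff L).2 ⟨hp.lamY_pos L, le_rfl,
    by positivity, ?_, hline.le⟩) hB hline ?_ (.inl rfl)
  · rw [hp.cap_lamY]
    have h1 := hp.budget_slack L D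
    have h2 : 0 < (L : ℝ) * (p.varX - D) := mul_pos h0 (by linarith)
    exact le_of_mul_le_mul_left (by linarith) hB
  · rw [hβ']
    rcases hstat.eq_or_lt with h | h
    · have := hp.stat_eq hs hL D
      rw [← h] at this; exact this.le
    · exact (lt_of_not_ge fun h' => h.not_ge ((hp.stat_le_iff hs hL).2 h')).le

end Admissible

/-! ### Calculus of error terms -/

section general

open Topology

lemma tendsto_one_div_nat : Tendsto (fun L : ℕ => 1 / (L : ℝ)) atTop (𝓝 0) :=
  tendsto_one_div_atTop_nhds_zero_nat

lemma tendsto_one_div_sqrt_nat : Tendsto (fun L : ℕ => 1 / √(L : ℝ)) atTop (𝓝 0) := by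
  simp only [one_div]
  exact (Real.tendsto_sqrt_atTop.comp tendsto_natCast_atTop_atTop).inv_tendsto_atTop

lemma isBigO_one_div_nat_sqrt :
    (fun L : ℕ => 1 / (L : ℝ)) =O[atTop] fun L : ℕ => 1 / √(L : ℝ) := by
  refine IsBigO.of_bound 1 (eventually_atTop.2 ⟨1, fun L hL => ?_⟩)
  have h1 : (1 : ℝ) ≤ L := by exact_mod_cast hL
  rw [one_mul, Real.norm_of_nonneg (by positivity), Real.norm_of_nonneg (by positivity)]
  refine one_div_le_one_div_of_le (by positivity) ?_
  rw [Real.sqrt_le_left (by positivity)]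
  nlinarith

variable {w x y : ℕ → ℝ} {x₀ y₀ : ℝ}

lemma tendsto_of_isBigO_sub (hw : Tendsto w atTop (𝓝 0)) (h : (fun L => x L - x₀) =O[atTop] w) :
    Tendsto x atTop (𝓝 x₀) :=
  tendsto_sub_nhds_zero_iff.1 (h.trans_tendsto hw)

lemma isBigO_comp_sub {F : ℝ → ℝ} (hF : DifferentiableAt ℝ F x₀) (hw : Tendsto w atTop (𝓝 0))
    (h : (fun L => x L - x₀) =O[atTop] w) : (fun L => F (x L) - F x₀) =O[atTop] w :=
  (hF.isBigO_sub.comp_tendsto (tendsto_of_isBigO_sub hw h)).trans h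

/-- The source of the `O(1 / L)` estimates: a quantity that is a function of `1 / L` differentiable
at `0` is within `O(1 / L)` of its limit. -/
lemma isBigO_inv_nat_sub {F : ℝ → ℝ} (hF : DifferentiableAt ℝ F 0) :
    (fun L : ℕ => F (L : ℝ)⁻¹ - F 0) =O[atTop] fun L : ℕ => 1 / (L : ℝ) :=
  isBigO_comp_sub hF tendsto_one_div_nat (by simpa using isBigO_refl _ _)

lemma isBigO_add_sub (hx : (fun L => x L - x₀) =O[atTop] w) (hy : (fun L => y L - y₀) =O[atTop] w) :
    (fun L => x L + y L - (x₀ + y₀)) =O[atTop] w :=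
  (hx.add hy).congr_left fun L => by ring

lemma isBigO_const_mul_sub (c : ℝ) (hx : (fun L => x L - x₀) =O[atTop] w) :
    (fun L => c * x L - c * x₀) =O[atTop] w :=
  (hx.const_mul_left c).congr_left fun L => by ring

lemma isBigO_mul_sub (hw : Tendsto w atTop (𝓝 0)) (hx : (fun L => x L - x₀) =O[atTop] w)
    (hy : (fun L => y L - y₀) =O[atTop] w) :
    (fun L => x L * y L - x₀ * y₀) =O[atTop] w := by
  have h1 : (fun L => (x L - x₀) * y L) =O[atTop] w := by
    simpa using hx.mul ((tendsto_of_isBigO_sub hw hy).isBigO_one ℝ)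
  exact (h1.add (hy.const_mul_left x₀)).congr_left fun L => by ring

/-- As `max` is Lipschitz, the optimum `max cross stat` can be expanded without deciding which entry
is larger for each `L`. This covers the thresholds, where the two limits coincide. -/
lemma isBigO_max_sub (hx : (fun L => x L - x₀) =O[atTop] w)
    (hy : (fun L => y L - y₀) =O[atTop] w) :
    (fun L => max (x L) (y L) - max x₀ y₀) =O[atTop] w := by
  refine IsBigO.trans (IsBigO.of_bound 1 (.of_forall fun L => ?_)) (hx.norm_left.add hy.norm_left)
  rw [one_mul, Real.norm_eq_abs, Real.norm_eq_abs, Real.norm_eq_abs, Real.norm_eq_abs]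
  refine (abs_max_sub_max_le_max _ _ _ _).trans (le_trans ?_ (le_abs_self _))
  exact max_le (by linarith [abs_nonneg (y L - y₀)]) (by linarith [abs_nonneg (x L - x₀)])

lemma isBigO_log_sub (hx₀ : x₀ ≠ 0) (hw : Tendsto w atTop (𝓝 0))
    (h : (fun L => x L - x₀) =O[atTop] w) :
    (fun L => Real.log (x L) - Real.log x₀) =O[atTop] w :=
  isBigO_comp_sub (Real.differentiableAt_log hx₀) hw h

lemma abs_log_one_add_sub_le {t : ℝ} (ht : |t| ≤ 1 / 2) : |Real.log (1 + t) - t| ≤ 2 * t ^ 2 := by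
  have h := Real.abs_log_sub_add_sum_range_le (x := -t) (by rw [abs_neg]; linarith) 1
  simp only [Finset.sum_range_one, abs_neg, sub_neg_eq_add] at h
  norm_num at h
  rw [show Real.log (1 + t) - t = -t + Real.log (1 + t) by ring]
  refine h.trans ?_
  -- The Taylor remainder is `t ^ 2 / (1 - |t|)`; the constant `2` comes from `|t| ≤ 1 / 2`.
  rw [div_le_iff₀ (by linarith)]
  nlinarith [sq_nonneg t]

lemma abs_log_one_add_sub_sq_le {t : ℝ} (ht : |t| ≤ 1 / 2) :
    |Real.log (1 + t) - (t - t ^ 2 / 2)| ≤ 2 * |t| ^ 3 := by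
  have h := Real.abs_log_sub_add_sum_range_le (x := -t) (by rw [abs_neg]; linarith) 2
  simp only [Finset.sum_range_succ, Finset.sum_range_zero, abs_neg, sub_neg_eq_add] at h
  norm_num at h
  rw [show Real.log (1 + t) - (t - t ^ 2 / 2) = -t + t ^ 2 / 2 + Real.log (1 + t) by ring]
  refine h.trans ?_
  rw [div_le_iff₀ (by linarith)]
  nlinarith [pow_nonneg (abs_nonneg t) 3]

/-- `L log (1 + m / L) = m₀ + O(1 / L)` if `m = m₀ + O(1 / L)`. -/
lemma isBigO_mul_log_one_add {m : ℕ → ℝ} {m₀ : ℝ}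
    (h : (fun L => m L - m₀) =O[atTop] fun L : ℕ => 1 / (L : ℝ)) :
    (fun L : ℕ => L * Real.log (1 + m L / L) - m₀) =O[atTop] fun L : ℕ => 1 / (L : ℝ) := by
  have hm := tendsto_of_isBigO_sub tendsto_one_div_nat h
  have h0 : Tendsto (fun L : ℕ => m L / L) atTop (𝓝 0) := by
    simpa [div_eq_mul_inv] using hm.mul tendsto_one_div_nat
  have h1 : (fun L : ℕ => L * (Real.log (1 + m L / L) - m L / L)) =O[atTop]
      fun L : ℕ => (L : ℝ) * (m L / L) ^ 2 := by
    refine (isBigO_refl (fun L : ℕ => (L : ℝ)) atTop).mul (IsBigO.of_bound 2 ?_)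
    filter_upwards [(tendsto_order.1 h0.abs).2 (1 / 2) (by norm_num)] with L hL
    have := abs_log_one_add_sub_le (t := m L / L) hL.le
    rwa [Real.norm_eq_abs, norm_pow, Real.norm_eq_abs, sq_abs]
  have h2 : (fun L : ℕ => (L : ℝ) * (m L / L) ^ 2) =O[atTop] fun L : ℕ => 1 / (L : ℝ) := by
    have := ((hm.pow 2).isBigO_one ℝ).mul (isBigO_refl (fun L : ℕ => 1 / (L : ℝ)) atTop)
    simp only [one_mul] at this
    refine this.congr' (eventually_atTop.2 ⟨1, fun L hL => ?_⟩) .rfl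
    have : (L : ℝ) ≠ 0 := by positivity
    field_simp
  refine ((h1.trans h2).add h).congr' (eventually_atTop.2 ⟨1, fun L hL => ?_⟩) .rfl
  have : (L : ℝ) ≠ 0 := by positivity
  field_simp; ring

/-- The second-order analogue of `isBigO_mul_log_one_add`, at scale `1 / √L`. -/
lemma isBigO_mul_log_one_add_sqrt {m : ℕ → ℝ} {m₀ m₁ : ℝ}
    (h : (fun L : ℕ => m L - (m₀ + m₁ * (1 / √(L : ℝ)))) =O[atTop] fun L : ℕ => 1 / (L : ℝ)) :
    (fun L : ℕ => L * Real.log (1 + m L * (1 / √(L : ℝ))) - (m₀ * √(L : ℝ) + (m₁ - m₀ ^ 2 / 2)))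
      =O[atTop] fun L : ℕ => 1 / √(L : ℝ) := by
  have hsq : ∀ L : ℕ, √(L : ℝ) ^ 2 = L := fun L => Real.sq_sqrt (Nat.cast_nonneg L)
  have hm1 : (fun L : ℕ => m L - m₀) =O[atTop] fun L : ℕ => 1 / √(L : ℝ) := by
    refine ((h.trans isBigO_one_div_nat_sqrt).add
      ((isBigO_refl (fun L : ℕ => 1 / √(L : ℝ)) atTop).const_mul_left m₁)).congr_left
      fun L => by ring
  have hm := tendsto_of_isBigO_sub tendsto_one_div_sqrt_nat hm1
  have h0 : Tendsto (fun L : ℕ => m L * (1 / √(L : ℝ))) atTop (𝓝 0) := by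
    simpa using hm.mul tendsto_one_div_sqrt_nat
  have h1 : (fun L : ℕ => L * (Real.log (1 + m L * (1 / √(L : ℝ)))
      - (m L * (1 / √(L : ℝ)) - (m L * (1 / √(L : ℝ))) ^ 2 / 2))) =O[atTop]
      fun L : ℕ => (L : ℝ) * (m L * (1 / √(L : ℝ))) ^ 3 := by
    refine (isBigO_refl (fun L : ℕ => (L : ℝ)) atTop).mul (IsBigO.of_bound 2 ?_)
    filter_upwards [(tendsto_order.1 h0.abs).2 (1 / 2) (by norm_num)] with L hL
    have := abs_log_one_add_sub_sq_le (t := m L * (1 / √(L : ℝ))) hL.le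
    rwa [Real.norm_eq_abs, norm_pow, Real.norm_eq_abs]
  have h2 : (fun L : ℕ => (L : ℝ) * (m L * (1 / √(L : ℝ))) ^ 3) =O[atTop]
      fun L : ℕ => 1 / √(L : ℝ) := by
    have := ((hm.pow 3).isBigO_one ℝ).mul (isBigO_refl (fun L : ℕ => 1 / √(L : ℝ)) atTop)
    simp only [one_mul] at this
    refine this.congr' (eventually_atTop.2 ⟨1, fun L hL => ?_⟩) .rfl
    have h3 : √(L : ℝ) ≠ 0 := by positivity
    dsimp only
    nth_rw 2 [← hsq L]
    field_simp
  have h3 : (fun L : ℕ => √(L : ℝ) * (m L - (m₀ + m₁ * (1 / √(L : ℝ))))) =O[atTop]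
      fun L : ℕ => 1 / √(L : ℝ) := by
    refine ((isBigO_refl (fun L : ℕ => √(L : ℝ)) atTop).mul h).congr' .rfl
      (eventually_atTop.2 ⟨1, fun L hL => ?_⟩)
    have h3 : √(L : ℝ) ≠ 0 := by positivity
    dsimp only
    nth_rw 2 [← hsq L]
    field_simp
  -- The quadratic Taylor term contributes `-m ^ 2 / 2`, replaced here by its limit.
  have h4 := (isBigO_mul_sub tendsto_one_div_sqrt_nat hm1 hm1).const_mul_left (1 / 2)
  refine (((h1.trans h2).add h3).sub h4).congr' (eventually_atTop.2 ⟨1, fun L hL => ?_⟩) .rfl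
  have h5 : √(L : ℝ) ≠ 0 := by positivity
  dsimp only
  generalize Real.log (1 + m L * (1 / √(L : ℝ))) = ℓ
  have h6 := hsq L
  generalize √(L : ℝ) = q at h5 h6 ⊢
  generalize (L : ℝ) = N at h6 ⊢
  subst h6
  field_simp
  ring

end general

/-! ### Differentiability at `1 / L = 0` -/

section differentiability

lemma differentiableAt_lev (p : SymGauss) (e : ℝ) : DifferentiableAt ℝ p.lev e := by
  unfold lev; fun_prop

lemma lev_zero (p : SymGauss) : p.lev 0 = p.covY := by simp [lev]

lemma slope_zero (p : SymGauss) : p.slope 0 = (p.covX / p.covY) ^ 2 := by simp [slope]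

lemma quadC_zero (p : SymGauss) (D : ℝ) : p.quadC D 0 = p.excess D * p.gamY * p.covY := by
  simp [quadC, lev]

lemma quadB_zero (p : SymGauss) (D : ℝ) : p.quadB D 0 = p.covY * (p.gap - p.excess D) := by
  simp [quadB]

lemma quadDisc_zero (p : SymGauss) (D : ℝ) :
    p.quadDisc D 0 = (p.covY * (p.gap - p.excess D)) ^ 2 := by
  simp [quadDisc, quadB_zero]

variable (hs : 0 < p.covY)
include hs

lemma differentiableAt_slope : DifferentiableAt ℝ p.slope 0 := by
  have h1 := p.differentiableAt_lev 0
  have h2 : p.lev 0 ≠ 0 := by rw [lev_zero]; exact hs.ne'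
  unfold slope; fun_prop (disch := assumption)

lemma differentiableAt_quadB1 (hg : 0 < p.gamY) : DifferentiableAt ℝ p.quadB1 0 := by
  have h1 := p.differentiableAt_lev 0
  have h2 : p.gamY * p.lev 0 ≠ 0 := by rw [lev_zero]; positivity
  have h3 := differentiableAt_slope hs
  unfold quadB1; fun_prop (disch := assumption)

lemma differentiableAt_quadB (hg : 0 < p.gamY) (D : ℝ) : DifferentiableAt ℝ (p.quadB D) 0 := by
  have h3 := differentiableAt_quadB1 hs hg
  unfold quadB; fun_prop

omit hs in
lemma differentiableAt_quadC (D : ℝ) : DifferentiableAt ℝ (p.quadC D) 0 := by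
  have h1 := p.differentiableAt_lev 0
  unfold quadC; fun_prop

lemma differentiableAt_quadDisc (hg : 0 < p.gamY) (D : ℝ) :
    DifferentiableAt ℝ (p.quadDisc D) 0 := by
  have h1 := differentiableAt_quadB hs hg D
  have h2 := differentiableAt_quadC (p := p) D
  have h3 := differentiableAt_slope hs
  unfold quadDisc; fun_prop

end differentiability

/-! ### Asymptotics of the optimal value -/

namespace Admissible

variable (hp : p.Admissible)
include hp

open Topology

lemma eventually_quadC_pos (hs : 0 < p.covY) {D : ℝ} (hd : 0 < p.excess D) :
    ∀ᶠ L : ℕ in atTop, 0 < p.quadC D (L : ℝ)⁻¹ := by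
  have h := (differentiableAt_quadC (p := p) D).continuousAt.tendsto.comp
    (tendsto_inv_atTop_zero.comp (tendsto_natCast_atTop_atTop (R := ℝ)))
  rw [quadC_zero] at h
  have := hp.gamY_pos
  exact (tendsto_order.1 h).1 0 (by positivity)

omit hp in
lemma _root_.SymGauss.slopeB_pos (hg : 0 < p.gamY) (hk : 0 < p.gap) {L : ℕ} (hL : 2 ≤ L) :
    0 < p.slopeB L := by
  rw [slopeB_eq]
  have : (2 : ℝ) ≤ L := by exact_mod_cast hL
  exact mul_pos (by linarith) (by positivity)

lemma gap_pos (hk : 0 < p.gamX) : 0 < p.gap := by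
  have := hp.gamY_pos
  unfold gap; positivity

lemma tendsto_lamY (hs : 0 < p.covY) : Tendsto p.lamY atTop atTop := by
  rw [show p.lamY = fun L : ℕ => p.gamY + L * p.covY from funext hp.lamY_eq]
  exact tendsto_atTop_add_const_left _ _ (tendsto_natCast_atTop_atTop.atTop_mul_const hs)

/-- The limit of the stationary point. -/
def _root_.SymGauss.statLim (p : SymGauss) (D : ℝ) : ℝ :=
  p.excess D / (p.covX / p.covY) ^ 2 - p.gamY

lemma stat_eq_comp (hs : 0 < p.covY) {L : ℕ} (hL : 1 ≤ L) (D : ℝ) :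
    p.stat L D = ((p.excess D - p.skew ^ 2 * p.covY * (L : ℝ)⁻¹ / (p.gamY * p.lev (L : ℝ)⁻¹)) /
      p.slope (L : ℝ)⁻¹ - p.lev (L : ℝ)⁻¹ * p.gamY / p.covY) / (1 + (L : ℝ)⁻¹) := by
  have h0 : (0 : ℝ) < L := by positivity
  have h1 := (hp.slope_pos hs hL).ne'
  rw [stat, hp.slopeA_eq hs hL, hp.budget_eq hs hL, hp.lamY_eq_lev hL]
  generalize p.excess D - p.skew ^ 2 * p.covY * (L : ℝ)⁻¹ / (p.gamY * p.lev (L : ℝ)⁻¹) = x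
  generalize p.lev (L : ℝ)⁻¹ = y
  generalize p.slope (L : ℝ)⁻¹ = z at *
  field_simp

/-- Positivity of `covX` keeps the limiting slope nonzero, so `stat` converges; this fails for
uncorrelated `X`. -/
lemma isBigO_stat (hs : 0 < p.covY) (hr : 0 < p.covX) (D : ℝ) :
    (fun L : ℕ => p.stat L D - p.statLim D) =O[atTop] fun L : ℕ => 1 / (L : ℝ) := by
  have hg := hp.gamY_pos
  have h1 := p.differentiableAt_lev 0
  have h2 : p.gamY * p.lev 0 ≠ 0 := by rw [lev_zero]; positivity
  have h3 := differentiableAt_slope hs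
  have h4 : p.slope 0 ≠ 0 := by rw [slope_zero]; positivity
  have h5 : (1 : ℝ) + 0 ≠ 0 := by norm_num
  have hF : DifferentiableAt ℝ (fun e => ((p.excess D - p.skew ^ 2 * p.covY * e /
      (p.gamY * p.lev e)) / p.slope e - p.lev e * p.gamY / p.covY) / (1 + e)) 0 := by
    fun_prop (disch := assumption)
  refine (isBigO_inv_nat_sub hF).congr' (eventually_atTop.2 ⟨1, fun L hL => ?_⟩) .rfl
  dsimp only
  rw [hp.stat_eq_comp hs hL, statLim, lev_zero, slope_zero]
  congr 1
  field_simp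
  ring

/-- The limit of the crossing point below `Dth0`. -/
def _root_.SymGauss.crossLim (p : SymGauss) (D : ℝ) : ℝ :=
  p.excess D * p.gamY / (p.gap - p.excess D)

/-- Below `Dth0` the discriminant and the denominator of `cross` are nonzero at `0`, so `cross` is
differentiable there. -/
lemma isBigO_cross (hs : 0 < p.covY) {D : ℝ} (hd : p.excess D < p.gap) :
    (fun L : ℕ => p.cross D (L : ℝ)⁻¹ - p.crossLim D) =O[atTop] fun L : ℕ => 1 / (L : ℝ) := by
  have hg := hp.gamY_pos
  have hd' := sub_pos.2 hd
  have hd'' := hd'.ne'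
  have h1 := differentiableAt_quadB hs hg D
  have h2 := differentiableAt_quadC (p := p) D
  have h3 := differentiableAt_quadDisc hs hg D
  have h4 : p.quadDisc D 0 ≠ 0 := by rw [quadDisc_zero]; positivity
  have h5' : p.quadB D 0 + √(p.quadDisc D 0) = 2 * (p.covY * (p.gap - p.excess D)) := by
    rw [quadDisc_zero, Real.sqrt_sq (by positivity), quadB_zero]; ring
  have h5 : p.quadB D 0 + √(p.quadDisc D 0) ≠ 0 := by rw [h5']; positivity
  have hF : DifferentiableAt ℝ (p.cross D) 0 := by
    unfold cross; fun_prop (disch := assumption)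
  have h6 : p.cross D 0 = p.crossLim D := by
    rw [cross, h5', quadC_zero, crossLim]; field_simp
  rw [← h6]
  exact isBigO_inv_nat_sub hF

lemma eventually_stat_le (hs : 0 < p.covY) (hr : 0 < p.covX) (D : ℝ) {x : ℕ → ℝ}
    (hx : Tendsto x atTop atTop) : ∀ᶠ L : ℕ in atTop, p.stat L D ≤ x L := by
  have h := tendsto_of_isBigO_sub tendsto_one_div_nat (hp.isBigO_stat hs hr D)
  filter_upwards [(tendsto_order.1 h).2 _ (lt_add_one _), hx.eventually_ge_atTop (p.statLim D + 1)]
    with L h1 h2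
  linarith

lemma eventually_isLeast_max (hs : 0 < p.covY) (hr : 0 < p.covX) (hk : 0 < p.gamX) {D : ℝ}
    (hd : 0 < p.excess D) (hD : D < p.varX) :
    ∀ᶠ L : ℕ in atTop, IsLeast (p.values L D)
      (p.lineValue L D (max (p.cross D (L : ℝ)⁻¹) (p.stat L D))) := by
  filter_upwards [hp.eventually_quadC_pos hs hd, eventually_ge_atTop 2,
    hp.eventually_stat_le hs hr D (hp.tendsto_lamY hs)] with L h1 h2 h3
  exact hp.isLeast_max hs (by omega) hD h1 (slopeB_pos hp.gamY_pos (hp.gap_pos hk) h2) h3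

/-- Numerator and denominator are `L * gap` and `L * excess` up to factors `1 + O(1 / L)`, and `L`
times the logarithm of such a factor has a finite limit. -/
lemma isBigO_budget_log (hs : 0 < p.covY) (hk : 0 < p.gamX) {D : ℝ} (hd : 0 < p.excess D)
    {y : ℕ → ℝ} {y₀ : ℝ} (hy : (fun L => y L - y₀) =O[atTop] fun L : ℕ => 1 / (L : ℝ)) :
    (fun L : ℕ => L * Real.log (p.gamY * p.slopeB L / (p.budget L D - y L))
      - (L * Real.log (p.gap / p.excess D) - 1 + (p.skew ^ 2 / p.gamY + y₀) / p.excess D))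
      =O[atTop] fun L : ℕ => 1 / (L : ℝ) := by
  have hg := hp.gamY_pos
  have hK := hp.gap_pos hk
  have h1 := p.differentiableAt_lev 0
  have h2 : p.gamY * p.lev 0 ≠ 0 := by rw [lev_zero]; positivity
  have hF : DifferentiableAt ℝ (fun e => p.skew ^ 2 * p.covY / (p.gamY * p.lev e)) 0 := by
    fun_prop (disch := assumption)
  have hm1 := isBigO_inv_nat_sub hF
  rw [lev_zero, mul_div_mul_right _ _ hs.ne'] at hm1
  have hm2 := isBigO_const_mul_sub (-(p.excess D)⁻¹) (isBigO_add_sub hm1 hy)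
  have hm3 := isBigO_mul_log_one_add hm2
  -- The constant sequence `-1` treats the factor `L - 1 = L * (1 - 1 / L)` of `slopeB`; it produces
  -- the `-1` in the expansion.
  have hc : (fun L : ℕ => (-1 : ℝ) - (-1)) =O[atTop] fun L : ℕ => 1 / (L : ℝ) := by
    simpa using isBigO_zero _ _
  have hc3 := isBigO_mul_log_one_add hc
  have ht := tendsto_of_isBigO_sub tendsto_one_div_nat hm2
  have ht0 : Tendsto (fun L : ℕ => 1 + -(p.excess D)⁻¹ * (p.skew ^ 2 * p.covY /
      (p.gamY * p.lev (L : ℝ)⁻¹) + y L) / L) atTop (𝓝 1) := by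
    simpa [div_eq_mul_inv] using (ht.mul tendsto_one_div_nat).const_add 1
  refine (hc3.sub hm3).congr' ?_ .rfl
  filter_upwards [eventually_ge_atTop 2, (tendsto_order.1 ht0).1 0 one_pos] with L hL hpos
  have hL' : (2 : ℝ) ≤ L := by exact_mod_cast hL
  have h0 : (0 : ℝ) < L := by positivity
  have hl := (hp.lev_pos hs (e := (L : ℝ)⁻¹) (by positivity)).ne'
  have hneg : (0 : ℝ) < 1 + -1 / L := by
    rw [neg_div, ← sub_eq_add_neg, sub_pos, div_lt_one h0]; linarith
  have e1 : p.gamY * p.slopeB L = L * (p.gap * (1 + -1 / L)) := by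
    rw [slopeB_eq]; field_simp; ring
  have e2 : p.budget L D - y L = L * (p.excess D * (1 + -(p.excess D)⁻¹ *
      (p.skew ^ 2 * p.covY / (p.gamY * p.lev (L : ℝ)⁻¹) + y L) / L)) := by
    rw [hp.budget_eq hs (by omega)]
    generalize p.lev (L : ℝ)⁻¹ = l at *
    field_simp; ring
  rw [e1, e2]
  generalize 1 + -(p.excess D)⁻¹ * (p.skew ^ 2 * p.covY / (p.gamY * p.lev (L : ℝ)⁻¹) + y L) / L
    = z at *
  rw [mul_div_mul_left _ _ h0.ne', Real.log_div (by positivity) (by positivity),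
    Real.log_mul (by positivity) (by positivity), Real.log_mul (by positivity) (by positivity),
    Real.log_div (by positivity) (by positivity)]
  field_simp
  ring

lemma isBigO_lineValue (hs : 0 < p.covY) (hk : 0 < p.gamX) {D : ℝ} (hd : 0 < p.excess D)
    {α : ℕ → ℝ} {A : ℝ} (hA : 0 < A + p.gamY)
    (hα : (fun L => α L - A) =O[atTop] fun L : ℕ => 1 / (L : ℝ)) :
    (fun L : ℕ => p.lineValue L D (α L) - (L / 2 * Real.log (p.gap / p.excess D)
      + 1 / 2 * Real.log L + 1 / 2 * Real.log (p.covY / (A + p.gamY)) - 1 / 2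
      + (p.skew ^ 2 / p.gamY + (p.covX / p.covY) ^ 2 * A) / (2 * p.excess D)))
      =O[atTop] fun L : ℕ => 1 / (L : ℝ) := by
  have hg := hp.gamY_pos
  have hs1 := isBigO_inv_nat_sub (differentiableAt_slope hs)
  rw [slope_zero] at hs1
  have hy := isBigO_mul_sub tendsto_one_div_nat hs1 hα
  have hlog2 := (hp.isBigO_budget_log hs hk hd hy).const_mul_left (1 / 2)
  have hlev := isBigO_inv_nat_sub (p.differentiableAt_lev 0)
  rw [lev_zero] at hlev
  have hu := isBigO_add_sub (isBigO_const_mul_sub p.covY hα) (isBigO_const_mul_sub p.gamY hlev)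
  have hu0 : 0 < p.covY * A + p.gamY * p.covY := by
    have := mul_pos hs hA; linarith
  have hlogu := isBigO_log_sub hu0.ne' tendsto_one_div_nat hu
  have hlogl := isBigO_log_sub hs.ne' tendsto_one_div_nat hlev
  have hut := tendsto_of_isBigO_sub tendsto_one_div_nat hu
  refine ((hlogl.sub (hlogu.const_mul_left (1 / 2))).add hlog2).congr' ?_ .rfl
  filter_upwards [eventually_ge_atTop 1, (tendsto_order.1 hut).1 0 hu0] with L hL hpos
  have h0 : (0 : ℝ) < L := by positivity
  have hl := hp.lev_pos hs (e := (L : ℝ)⁻¹) (by positivity)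
  have e0 : p.lamY L - p.gamY = L * p.covY := by rw [hp.lamY_eq]; ring
  have e3 : p.covY * A + p.gamY * p.covY = p.covY * (A + p.gamY) := by ring
  rw [lineValue, hp.slopeA_eq hs hL, e0, hp.lamY_eq_lev hL]
  have e1 : L * p.covY * α L + L * p.lev (L : ℝ)⁻¹ * p.gamY =
     L * (p.covY * α L + p.gamY * p.lev (L : ℝ)⁻¹) := by ring
  generalize Real.log (p.gamY * p.slopeB L / (p.budget L D - p.slope (L : ℝ)⁻¹ * α L)) = q
  rw [e1, e3, Real.log_div (x := (L * p.lev (L : ℝ)⁻¹) ^ 2) (by positivity) (by positivity),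
    Real.log_pow, Real.log_mul (x := p.covY) hs.ne' hA.ne', Real.log_mul h0.ne' hl.ne',
    Real.log_mul h0.ne' hpos.ne', Real.log_div hs.ne' hA.ne']
  push_cast
  field_simp
  ring

/-- The objective on the curve where `β` equals its cap, in terms of `t = 1 / α`. -/
lemma omega_cap (L : ℕ) {α : ℝ} (hα : 0 < α) : p.Omega L α (p.cap L α) (p.cap L α) =
    1 / 2 * Real.log (p.lamY L ^ 2 * α⁻¹ / (L * p.covY + p.lamY L * p.gamY * α⁻¹))
      + L / 2 * Real.log (1 + (p.gamY * α⁻¹ - p.gamY / p.lamY L)) := by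
  have hg := hp.gamY_pos
  have hl := hp.lamY_pos L
  have hu := hp.denom_pos L hα
  have e0 : p.lamY L - p.gamY = L * p.covY := by rw [hp.lamY_eq]; ring
  have e1 : p.gamY / p.cap L α = 1 + (p.gamY * α⁻¹ - p.gamY / p.lamY L) := by
    unfold cap; field_simp; ring
  rw [hp.omega_eq, e1]
  congr 3
  rw [e0] at hu ⊢
  have : L * p.covY + p.lamY L * p.gamY * α⁻¹ =
      (L * p.covY * α + p.lamY L * p.gamY) / α := by field_simp
  rw [this]
  field_simp

/-- At `e = 0` one has `√quadDisc = |quadB| = -quadB`, so the reciprocal of `cross` tends to zero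
through positive values. -/
lemma tendsto_cross (hs : 0 < p.covY) {D : ℝ} (hd : 0 < p.excess D) (hK : p.gap ≤ p.excess D) :
    Tendsto (fun L : ℕ => p.cross D (L : ℝ)⁻¹) atTop atTop := by
  have hg := hp.gamY_pos
  have h1 := (differentiableAt_quadB hs hg D).continuousAt
  have h2 := (differentiableAt_quadC (p := p) D).continuousAt
  have h3 := (differentiableAt_quadDisc hs hg D).continuousAt
  have h4 : 2 * p.quadC D 0 ≠ 0 := by rw [quadC_zero]; positivity
  have hc : ContinuousAt (fun e => (p.quadB D e + √(p.quadDisc D e)) / (2 * p.quadC D e)) 0 := by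
    fun_prop (disch := assumption)
  have h0 : p.quadB D 0 + √(p.quadDisc D 0) = 0 := by
    rw [quadDisc_zero, Real.sqrt_sq_eq_abs, quadB_zero, abs_of_nonpos]
    · ring
    · exact mul_nonpos_of_nonneg_of_nonpos hs.le (by linarith)
  have ht := hc.tendsto.comp (tendsto_inv_atTop_zero.comp (tendsto_natCast_atTop_atTop (R := ℝ)))
  rw [h0, zero_div] at ht
  have ht' := (tendsto_nhdsWithin_iff (s := Set.Ioi 0)).2 ⟨ht, by
    filter_upwards [hp.eventually_quadC_pos hs hd, eventually_ge_atTop 1] with L hC hL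
    exact div_pos (hp.cross_denom_pos hs hL hC) (by simpa using hC)⟩
  refine (tendsto_inv_nhdsGT_zero.comp ht').congr fun L => ?_
  simp [cross]

lemma eventually_isLeast_cross (hs : 0 < p.covY) (hr : 0 < p.covX) {D : ℝ}
    (hd : 0 < p.excess D) (hK : p.gap ≤ p.excess D) (hD : D < p.varX) :
    ∀ᶠ L : ℕ in atTop, IsLeast (p.values L D) (p.Omega L (p.cross D (L : ℝ)⁻¹)
      (p.cap L (p.cross D (L : ℝ)⁻¹)) (p.cap L (p.cross D (L : ℝ)⁻¹))) := by
  filter_upwards [hp.eventually_quadC_pos hs hd, eventually_ge_atTop 1,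
    hp.eventually_stat_le hs hr D (hp.tendsto_cross hs hd hK)] with L h1 h2 h3
  exact hp.isLeast_cross hs h2 hD h1 h3

/-- The optimal value above `Dth0`. -/
lemma isBigO_lowerR_of_gap_lt (hs : 0 < p.covY) (hr : 0 < p.covX) {D : ℝ}
    (hd : 0 < p.excess D) (hK : p.gap < p.excess D) (hD : D < p.varX) :
    (fun L : ℕ => p.lowerR L D
      - (1 / 2 * Real.log (p.covY * ((p.covX / p.covY) ^ 2 / (p.excess D - p.gap)))
        + 1 / 2 * (p.gamY * ((p.covX / p.covY) ^ 2 / (p.excess D - p.gap)) - p.gamY / p.covY)))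
      =O[atTop] fun L : ℕ => 1 / (L : ℝ) := by
  have hg := hp.gamY_pos
  have hd' := sub_pos.2 hK
  have hd'' := hd'.ne'
  have h0 := p.differentiableAt_lev 0
  have h0' : p.lev 0 ≠ 0 := by rw [lev_zero]; exact hs.ne'
  have h1 := differentiableAt_quadB hs hg D
  have h2 := differentiableAt_slope hs
  have h3 := differentiableAt_quadDisc hs hg D
  have h4 : p.quadDisc D 0 ≠ 0 := by
    rw [quadDisc_zero, ← neg_sub (p.excess D), mul_neg, neg_sq]; positivity
  have h5' : √(p.quadDisc D 0) - p.quadB D 0 = 2 * (p.covY * (p.excess D - p.gap)) := by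
    rw [quadDisc_zero, ← neg_sub (p.excess D), mul_neg, neg_sq, Real.sqrt_sq (by positivity), quadB_zero]; ring
  have h5 : √(p.quadDisc D 0) - p.quadB D 0 ≠ 0 := by rw [h5']; positivity
  -- Above `Dth0` the sum `quadB + √quadDisc` cancels in the limit. Multiplying by the conjugate
  -- exposes a factor `e`, so that `1 / cross = e * ι e` with `ι` smooth enough at `0`.
  set ι : ℝ → ℝ := fun e => 2 * p.slope e * p.covY / (√(p.quadDisc D e) - p.quadB D e) with hι
  have hιd : DifferentiableAt ℝ ι 0 := by
    rw [hι]; fun_prop (disch := assumption)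
  have hι0 : ι 0 = (p.covX / p.covY) ^ 2 / (p.excess D - p.gap) := by
    simp only [hι]; rw [h5', slope_zero]; field_simp
  have hpos : 0 < ι 0 := by rw [hι0]; positivity
  have hGd : DifferentiableAt ℝ
      (fun e => p.lev e ^ 2 * ι e / (p.covY + e * p.lev e * p.gamY * ι e)) 0 := by
    have : p.covY + 0 * p.lev 0 * p.gamY * ι 0 ≠ 0 := by simpa using hs.ne'
    fun_prop (disch := assumption)
  have hG := isBigO_inv_nat_sub hGd
  rw [lev_zero, show p.covY ^ 2 * ι 0 / (p.covY + 0 * p.covY * p.gamY * ι 0) = p.covY * ι 0 by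
    field_simp; ring] at hG
  have hGlog := isBigO_log_sub (by positivity) tendsto_one_div_nat hG
  have hMd : DifferentiableAt ℝ (fun e => p.gamY * ι e - p.gamY / p.lev e) 0 := by
    fun_prop (disch := assumption)
  have hM := isBigO_mul_log_one_add (isBigO_inv_nat_sub hMd)
  rw [lev_zero] at hM
  rw [← hι0]
  refine ((hGlog.const_mul_left (1 / 2)).add (hM.const_mul_left (1 / 2))).congr' ?_ .rfl
  filter_upwards [hp.eventually_isLeast_cross hs hr hd hK.le hD, hp.eventually_quadC_pos hs hd,
    eventually_ge_atTop 1] with L hmin hC hL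
  have hL0 : (0 : ℝ) < L := by positivity
  have hα := hp.cross_pos hs hL hC
  have hinv : (p.cross D (L : ℝ)⁻¹)⁻¹ = ι (L : ℝ)⁻¹ / L := by
    have hsq : √(p.quadDisc D (L : ℝ)⁻¹) ^ 2 = p.quadDisc D (L : ℝ)⁻¹ := by
      refine Real.sq_sqrt ?_
      have := hp.slope_pos hs hL
      unfold quadDisc; positivity
    have hgt := hp.quadDisc_gt hs hL hC
    have hne : √(p.quadDisc D (L : ℝ)⁻¹) - p.quadB D (L : ℝ)⁻¹ ≠ 0 :=
      (sub_pos.2 ((le_abs_self _).trans_lt hgt)).ne'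
    simp only [hι]
    rw [cross, inv_div, div_div, div_eq_div_iff (by positivity) (by positivity)]
    have hLe : (L : ℝ) * (L : ℝ)⁻¹ = 1 := mul_inv_cancel₀ hL0.ne'
    generalize √(p.quadDisc D (L : ℝ)⁻¹) = R at *
    rw [quadDisc] at hsq
    linear_combination (L : ℝ) * hsq + 4 * p.slope (L : ℝ)⁻¹ * p.covY * p.quadC D (L : ℝ)⁻¹ * hLe
  rw [lowerR_eq_of_isLeast hmin, hp.omega_cap L hα, hinv, hp.lamY_eq_lev hL]
  have hl := hp.lev_pos hs (e := (L : ℝ)⁻¹) (by positivity)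
  have e1 : (L * p.lev (L : ℝ)⁻¹) ^ 2 * (ι (L : ℝ)⁻¹ / L) /
      (L * p.covY + L * p.lev (L : ℝ)⁻¹ * p.gamY * (ι (L : ℝ)⁻¹ / L)) =
      p.lev (L : ℝ)⁻¹ ^ 2 * ι (L : ℝ)⁻¹ /
        (p.covY + (L : ℝ)⁻¹ * p.lev (L : ℝ)⁻¹ * p.gamY * ι (L : ℝ)⁻¹) := by
    rw [← mul_div_mul_left _ (p.covY + _) hL0.ne']
    congr 1 <;> field_simp
  have e2 : p.gamY * (ι (L : ℝ)⁻¹ / L) - p.gamY / (L * p.lev (L : ℝ)⁻¹) =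
      (p.gamY * ι (L : ℝ)⁻¹ - p.gamY / p.lev (L : ℝ)⁻¹) / L := by
    field_simp
  rw [e1, e2]
  ring

/-- The optimal value at `Dth0`. -/
lemma isBigO_lowerR_of_gap_eq (hs : 0 < p.covY) (hr : 0 < p.covX) {D : ℝ}
    (hd : 0 < p.excess D) (hK : p.excess D = p.gap) (hD : D < p.varX) {V₀ V₁ : ℝ}
    (hV₀ : V₀ = √(4 * (p.slope 0 * p.covY * p.quadC D 0)) / (2 * p.quadC D 0))
    (hV₁ : V₁ = p.quadB1 0 / (2 * p.quadC D 0)) :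
    (fun L : ℕ => p.lowerR L D - (1 / 4 * Real.log L + 1 / 2 * Real.log (p.covY * V₀)
        + 1 / 2 * (p.gamY * V₀ * √(L : ℝ) +
          (p.gamY * V₁ - p.gamY / p.covY - (p.gamY * V₀) ^ 2 / 2))))
      =O[atTop] fun L : ℕ => 1 / √(L : ℝ) := by
  have hg := hp.gamY_pos
  have h0 := p.differentiableAt_lev 0
  have h0' : p.lev 0 ≠ 0 := by rw [lev_zero]; exact hs.ne'
  have h1 := differentiableAt_quadB1 hs hg
  have h2 := differentiableAt_slope hs
  have h3 := differentiableAt_quadC (p := p) D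
  have hC0 : 0 < p.quadC D 0 := by rw [quadC_zero]; positivity
  have h4 : 2 * p.quadC D 0 ≠ 0 := by positivity
  have hs0 : 0 < p.slope 0 := by rw [slope_zero]; positivity
  -- At `Dth0` the discriminant equals `e * G e` with `G 0 > 0`. Its root gives a factor `1 / √L`,
  -- and `1 / cross = (f₂ + f₁ / √L) / √L`.
  set G : ℝ → ℝ := fun e => e * p.quadB1 e ^ 2 + 4 * (p.slope e * p.covY * p.quadC D e) with hG
  have hG0 : G 0 = 4 * (p.slope 0 * p.covY * p.quadC D 0) := by simp [hG]
  have hGd : DifferentiableAt ℝ G 0 := by rw [hG]; fun_prop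
  have hG0' : G 0 ≠ 0 := by rw [hG0]; positivity
  set f₁ : ℝ → ℝ := fun e => p.quadB1 e / (2 * p.quadC D e) with hf₁
  set f₂ : ℝ → ℝ := fun e => √(G e) / (2 * p.quadC D e) with hf₂
  have hf₁d : DifferentiableAt ℝ f₁ 0 := by rw [hf₁]; fun_prop (disch := assumption)
  have hf₂d : DifferentiableAt ℝ f₂ 0 := by rw [hf₂]; fun_prop (disch := assumption)
  have hV₀' : f₂ 0 = V₀ := by rw [hV₀, ← hG0]
  have hV₁' : f₁ 0 = V₁ := by rw [hV₁]
  have hV₀pos : 0 < V₀ := by rw [hV₀]; positivity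
  have hη : (fun L : ℕ => 1 / √(L : ℝ) - 0) =O[atTop] fun L : ℕ => 1 / √(L : ℝ) := by
    simpa using isBigO_refl _ _
  have ht := tendsto_one_div_sqrt_nat
  have O₁ := isBigO_inv_nat_sub hf₁d
  have O₂ := isBigO_inv_nat_sub hf₂d
  have O₃d : DifferentiableAt ℝ (fun e => p.gamY / p.lev e) 0 := by
    fun_prop (disch := assumption)
  have O₃ := isBigO_inv_nat_sub O₃d
  have O₄ := isBigO_inv_nat_sub h0
  rw [hV₁'] at O₁
  rw [hV₀'] at O₂
  rw [lev_zero] at O₃ O₄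
  have OV : (fun L : ℕ => 1 / √(L : ℝ) * f₁ (L : ℝ)⁻¹ + f₂ (L : ℝ)⁻¹ - V₀) =O[atTop]
      fun L : ℕ => 1 / √(L : ℝ) := by
    simpa using isBigO_add_sub (isBigO_mul_sub ht hη (O₁.trans isBigO_one_div_nat_sqrt))
      (O₂.trans isBigO_one_div_nat_sqrt)
  have hm : (fun L : ℕ => (p.gamY * f₂ (L : ℝ)⁻¹ + 1 / √(L : ℝ) * (p.gamY * f₁ (L : ℝ)⁻¹
      - p.gamY / p.lev (L : ℝ)⁻¹)) - (p.gamY * V₀ + (p.gamY * V₁ - p.gamY / p.covY) *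
        (1 / √(L : ℝ)))) =O[atTop] fun L : ℕ => 1 / (L : ℝ) := by
    have h6 := (ht.isBigO_one ℝ).mul ((O₁.const_mul_left p.gamY).sub O₃)
    simp only [one_mul] at h6
    exact ((O₂.const_mul_left p.gamY).add h6).congr_left fun L => by ring
  -- Since `1 / cross` is of order `1 / √L`, the logarithm multiplied by `L` needs its second-order
  -- term to yield the constant.
  have hlog2 := isBigO_mul_log_one_add_sqrt hm
  have O₄' := O₄.trans isBigO_one_div_nat_sqrt
  have hden := isBigO_mul_sub ht (isBigO_mul_sub ht (isBigO_const_mul_sub p.gamY O₄') hη) OV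
  have hden' : (fun L : ℕ => (p.covY + p.gamY * p.lev (L : ℝ)⁻¹ * (1 / √(L : ℝ)) *
      (1 / √(L : ℝ) * f₁ (L : ℝ)⁻¹ + f₂ (L : ℝ)⁻¹)) - p.covY) =O[atTop]
      fun L : ℕ => 1 / √(L : ℝ) := by
    simpa using hden
  have hl1 := isBigO_log_sub hs.ne' ht O₄'
  have hl2 := isBigO_log_sub hV₀pos.ne' ht OV
  have hl3 := isBigO_log_sub hs.ne' ht hden'
  refine ((hl1.add ((hl2.sub hl3).const_mul_left (1 / 2))).add
    (hlog2.const_mul_left (1 / 2))).congr' ?_ .rfl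
  filter_upwards [hp.eventually_isLeast_cross hs hr hd hK.ge hD, hp.eventually_quadC_pos hs hd,
    eventually_ge_atTop 1,
    (tendsto_order.1 (tendsto_of_isBigO_sub ht OV)).1 0 hV₀pos] with L hmin hC hL hV
  have hL0 : (0 : ℝ) < L := by positivity
  have hq0 : 0 < √(L : ℝ) := Real.sqrt_pos.2 hL0
  have hqq : √(L : ℝ) ^ 2 = L := Real.sq_sqrt hL0.le
  have hα := hp.cross_pos hs hL hC
  set V := 1 / √(L : ℝ) * f₁ (L : ℝ)⁻¹ + f₂ (L : ℝ)⁻¹ with hVdef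
  have hinv : (p.cross D (L : ℝ)⁻¹)⁻¹ = V / √(L : ℝ) := by
    have hB : p.quadB D (L : ℝ)⁻¹ = (L : ℝ)⁻¹ * p.quadB1 (L : ℝ)⁻¹ := by
      rw [quadB, hK]; ring
    have hR : √(p.quadDisc D (L : ℝ)⁻¹) = (√(L : ℝ))⁻¹ * √(G (L : ℝ)⁻¹) := by
      have : p.quadDisc D (L : ℝ)⁻¹ = (L : ℝ)⁻¹ * G (L : ℝ)⁻¹ := by
        rw [quadDisc, hB]; simp only [hG]; ring
      rw [this, Real.sqrt_mul (by positivity), Real.sqrt_inv]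
    have hLq : (L : ℝ)⁻¹ = (√(L : ℝ))⁻¹ * (√(L : ℝ))⁻¹ := by
      rw [← mul_inv, Real.mul_self_sqrt hL0.le]
    rw [cross, inv_div, hB, hR, hVdef]
    simp only [hf₁, hf₂]
    nth_rw 1 [hLq]
    ring
  have hl := hp.lev_pos hs (e := (L : ℝ)⁻¹) (by positivity)
  rw [lowerR_eq_of_isLeast hmin, hp.omega_cap L hα, hinv, hp.lamY_eq_lev hL]
  have e1 : (L * p.lev (L : ℝ)⁻¹) ^ 2 * (V / √(L : ℝ)) /
      (L * p.covY + L * p.lev (L : ℝ)⁻¹ * p.gamY * (V / √(L : ℝ))) =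
      √(L : ℝ) * (p.lev (L : ℝ)⁻¹ ^ 2 * V /
        (p.covY + p.gamY * p.lev (L : ℝ)⁻¹ * (1 / √(L : ℝ)) * V)) := by
    rw [mul_div_assoc', ← mul_div_mul_left _ (p.covY + _) hL0.ne']
    generalize p.lev (L : ℝ)⁻¹ = l at *
    generalize √(L : ℝ) = q at *
    generalize (L : ℝ) = N at *
    clear_value V
    subst hqq
    field_simp
  have e2 : p.gamY * (V / √(L : ℝ)) - p.gamY / (L * p.lev (L : ℝ)⁻¹) =
      (p.gamY * f₂ (L : ℝ)⁻¹ + 1 / √(L : ℝ) * (p.gamY * f₁ (L : ℝ)⁻¹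
      - p.gamY / p.lev (L : ℝ)⁻¹)) * (1 / √(L : ℝ)) := by
    have : p.gamY / (L * p.lev (L : ℝ)⁻¹) =
        p.gamY / p.lev (L : ℝ)⁻¹ * (1 / √(L : ℝ)) * (1 / √(L : ℝ)) := by
      nth_rw 1 [← hqq]
      generalize p.lev (L : ℝ)⁻¹ = l at *
      field_simp
    rw [this, hVdef]; ring
  have hdenpos : 0 < p.covY + p.gamY * p.lev (L : ℝ)⁻¹ * (1 / √(L : ℝ)) * V := by positivity
  rw [e1, e2, Real.log_mul hq0.ne' (by positivity), Real.log_sqrt hL0.le,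
    Real.log_div (by positivity) hdenpos.ne', Real.log_mul (by positivity) hV.ne', Real.log_pow,
    Real.log_mul hs.ne' hV₀pos.ne']
  push_cast
  ring

/-- The optimal value below `Dth0`. -/
lemma isBigO_lowerR_of_lt_gap (hs : 0 < p.covY) (hr : 0 < p.covX) (hk : 0 < p.gamX) {D : ℝ}
    (hd : 0 < p.excess D) (hK : p.excess D < p.gap) (hD : D < p.varX) {A : ℝ}
    (hA : max (p.crossLim D) (p.statLim D) = A) :
    (fun L : ℕ => p.lowerR L D - (L / 2 * Real.log (p.gap / p.excess D)
      + 1 / 2 * Real.log L + 1 / 2 * Real.log (p.covY / (A + p.gamY)) - 1 / 2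
      + (p.skew ^ 2 / p.gamY + (p.covX / p.covY) ^ 2 * A) / (2 * p.excess D)))
      =O[atTop] fun L : ℕ => 1 / (L : ℝ) := by
  subst hA
  have hg := hp.gamY_pos
  have hc : 0 < p.crossLim D := div_pos (by positivity) (sub_pos.2 hK)
  have h := hp.isBigO_lineValue hs hk hd (by linarith [le_max_left (p.crossLim D) (p.statLim D)])
    (isBigO_max_sub (hp.isBigO_cross hs hK) (hp.isBigO_stat hs hr D))
  refine h.congr' ?_ .rfl
  filter_upwards [hp.eventually_isLeast_max hs hr hk hd hD] with L hL
  rw [lowerR_eq_of_isLeast hL]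

lemma slopeA_mul_lamY_sq {L : ℕ} (h : p.covX = 0) :
    p.slopeA L * p.lamY L ^ 2 = p.gamX ^ 2 := by
  have := (hp.lamY_pos L).ne'
  rw [slopeA, lamX_eq, h]; field_simp; simp

lemma eventually_isLeast_lamY (hs : 0 < p.covY) (hr : p.covX = 0) {D : ℝ}
    (hd : 0 < p.excess D) (hk : 0 < p.gamX) (hD : D < p.varX) :
    ∀ᶠ L : ℕ in atTop, IsLeast (p.values L D) (p.lineValue L D (p.lamY L)) := by
  have hg := hp.gamY_pos
  have h1 := p.differentiableAt_lev 0
  have h2 : p.gamY * p.lev 0 ≠ 0 := by rw [lev_zero]; positivity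
  have h3 := differentiableAt_slope hs
  have hF : DifferentiableAt ℝ (fun e => p.excess D - p.skew ^ 2 * p.covY * e /
      (p.gamY * p.lev e) - p.slope e * p.lev e) 0 := by
    fun_prop (disch := assumption)
  have ht := tendsto_of_isBigO_sub tendsto_one_div_nat (isBigO_inv_nat_sub hF)
  have h0 : p.excess D - p.skew ^ 2 * p.covY * 0 / (p.gamY * p.lev 0) - p.slope 0 * p.lev 0 =
      p.excess D := by
    rw [slope_zero, hr]; simp
  rw [h0] at ht
  have ht' := (tendsto_natCast_atTop_atTop (R := ℝ)).atTop_mul_pos hd ht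
  -- The bound `gamX ^ 2 / covY` is what `stat < lamY` would force on the remaining budget, because
  -- `slopeA * lamY ^ 2 = gamX ^ 2`. That budget grows linearly in `L`.
  filter_upwards [ht'.eventually_gt_atTop (p.gamX ^ 2 / p.covY), eventually_ge_atTop 2]
    with L h4 h5
  have hL : 1 ≤ L := by omega
  have hL0 : (0 : ℝ) < L := by positivity
  have e1 : p.budget L D - p.slopeA L * p.lamY L = L * (p.excess D - p.skew ^ 2 * p.covY *
      (L : ℝ)⁻¹ / (p.gamY * p.lev (L : ℝ)⁻¹) - p.slope (L : ℝ)⁻¹ * p.lev (L : ℝ)⁻¹) := by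
    rw [hp.budget_eq hs hL, hp.slopeA_eq hs hL, hp.lamY_eq_lev hL]; ring
  rw [← e1] at h4
  refine hp.isLeast_lamY hs hL hD (slopeB_pos hg (hp.gap_pos hk) h5)
    ((by positivity : (0 : ℝ) ≤ p.gamX ^ 2 / p.covY).trans_lt h4) (le_of_not_gt fun h => ?_)
  have h6 := (hp.stat_le_iff hs hL).1 h.le
  have e0 : p.lamY L - p.gamY = L * p.covY := by rw [hp.lamY_eq]; ring
  have h7 := hp.slopeA_mul_lamY_sq (L := L) hr
  rw [div_lt_iff₀ hs] at h4
  have e2 : L * p.slopeA L * ((p.lamY L - p.gamY) * p.lamY L + p.lamY L * p.gamY) =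
      L * p.gamX ^ 2 := by rw [← h7]; ring
  rw [e2, e0] at h6
  have := mul_lt_mul_of_pos_left h4 hL0
  linarith

/-- The optimal value for uncorrelated `X`. -/
lemma isBigO_lowerR_of_covX_eq_zero (hs : 0 < p.covY) (hr : p.covX = 0) (hk : 0 < p.gamX) {D : ℝ}
    (hd : 0 < p.excess D) (hD : D < p.varX) :
    (fun L : ℕ => p.lowerR L D - (L / 2 * Real.log (p.gap / p.excess D) - 1 / 2
      + p.skew ^ 2 / p.gamY / (2 * p.excess D))) =O[atTop] fun L : ℕ => 1 / (L : ℝ) := by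
  have hg := hp.gamY_pos
  have h1 := p.differentiableAt_lev 0
  have h2 : p.lev 0 ≠ 0 := by rw [lev_zero]; positivity
  have hF : DifferentiableAt ℝ (fun e => p.gamX ^ 2 * e / p.lev e) 0 := by
    fun_prop (disch := assumption)
  have hy := isBigO_inv_nat_sub hF
  have hlog := (hp.isBigO_budget_log hs hk hd hy).const_mul_left (1 / 2)
  refine hlog.congr' ?_ .rfl
  filter_upwards [hp.eventually_isLeast_lamY hs hr hd hk hD, eventually_ge_atTop 1] with L hmin hL
  have hL0 : (0 : ℝ) < L := by positivity
  have hl := hp.lev_pos hs (e := (L : ℝ)⁻¹) (by positivity)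
  have e1 : p.slopeA L * p.lamY L = p.gamX ^ 2 * (L : ℝ)⁻¹ / p.lev (L : ℝ)⁻¹ := by
    rw [← hp.slopeA_mul_lamY_sq (L := L) hr, hp.lamY_eq_lev hL]
    generalize p.lev (L : ℝ)⁻¹ = l at *
    field_simp
  have e2 : p.lamY L ^ 2 / ((p.lamY L - p.gamY) * p.lamY L + p.lamY L * p.gamY) = 1 := by
    have := hp.lamY_pos L
    rw [show (p.lamY L - p.gamY) * p.lamY L + p.lamY L * p.gamY = p.lamY L ^ 2 by ring]
    exact div_self (by positivity)
  rw [lowerR_eq_of_isLeast hmin, lineValue, e1, e2, Real.log_one]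
  simp only [mul_zero, zero_div, add_zero]
  field_simp
  ring

/-! ### Uncorrelated coordinates of `Y` -/

/-- The optimum for uncorrelated coordinates of `Y`, attained at `α = β = δ`. -/
lemma isLeast_of_covY_eq_zero (h : p.covY = 0) {D : ℝ} (hD : D ∈ Set.Ioo p.dminInf p.varX)
    {L : ℕ} (hL : 1 ≤ L) : IsLeast (p.values L D) (p.upperInf L D) := by
  have hg := hp.gamY_pos
  have hX := hp.varX_pos
  have hr : p.covX = 0 := by
    have h1 := hp.covX_nonneg
    have h2 := mul_nonneg hp.rhoZ_mem.1 hp.varZ_nonneg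
    have h3 : p.covX + p.rhoZ * p.varZ = 0 := h
    linarith
  have hl : p.lamY L = p.gamY := by rw [hp.lamY_eq, h]; ring
  have hk : p.gamX = p.varX := by rw [varX_eq, hr]; ring
  have hgv : p.gamY = p.varX + p.varZ := by rw [hp.gamY_eq, h, varY]; ring
  have hlx : p.lamX L = p.varX := by rw [lamX_eq, hr, hk]; ring
  have hL0 : (0 : ℝ) < L := by positivity
  obtain ⟨hD1, hD2⟩ := hD
  rw [dminInf, if_pos h, ← hgv, div_lt_iff₀ hg] at hD1
  have hcap : ∀ α, 0 < α → p.cap L α = α := fun α hα => by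
    rw [cap, hl]; field_simp; simp
  -- The solution of the distortion equation on the diagonal `α = β`.
  set τ := (p.gamY * D - p.varX * p.varZ) * p.gamY / p.varX ^ 2 with hτ
  have hnum : 0 < p.gamY * D - p.varX * p.varZ := by linarith
  have hτ0 : 0 < τ := by positivity
  have hA : p.slopeA L = p.varX ^ 2 / p.gamY ^ 2 := by rw [slopeA, hl, hlx]; rfl
  have hB : p.slopeB L = (L - 1) * (p.varX ^ 2 / p.gamY ^ 2) := by rw [slopeB, hk]; rfl
  have hc : p.budget L D = L * (p.varX ^ 2 / p.gamY ^ 2 * τ) := by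
    have : p.varZ = p.gamY - p.varX := by rw [hgv]; ring
    rw [budget, hl, hlx, hk, hτ, this]; field_simp; ring
  have hfeas : p.Feasible L D τ τ τ := by
    refine (hp.feasible_iff L).2 ⟨hτ0, ?_, hτ0, (hcap τ hτ0).ge, ?_⟩
    · rw [hl, hτ, div_le_iff₀ (by positivity), mul_comm]
      refine mul_le_mul_of_nonneg_left ?_ hg.le
      have := mul_lt_mul_of_pos_left hD2 hg
      rw [hgv] at this ⊢
      linarith
    · rw [hA, hB, hc]; apply le_of_eq; ring
  have hval : p.Omega L τ τ τ = p.upperInf L D := by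
    rw [hp.omega_eq, hl, upperInf, ← hgv]
    have e1 : p.gamY ^ 2 / ((p.gamY - p.gamY) * τ + p.gamY * p.gamY) = 1 := by
      rw [sub_self, zero_mul, zero_add, ← pow_two]; exact div_self (by positivity)
    have e2 : p.gamY / τ = p.varX ^ 2 / (p.gamY * D - p.varX * p.varZ) := by
      rw [hτ]; field_simp
    rw [e1, e2, Real.log_one]; ring
  rw [← hval]
  refine hp.isLeast_of_gradient hL hfeas fun α β h' => ?_
  obtain ⟨hα, -, hβ, hβα, hdist⟩ := (hp.feasible_iff L).1 h'
  rw [hcap α hα] at hβα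
  rw [hA, hB, hc] at hdist
  have ha : 0 < p.varX ^ 2 / p.gamY ^ 2 := by positivity
  -- As `β ≤ α`, the distortion constraint yields `β ≤ τ`; the `α`-part of the gradient vanishes
  -- because `lamY = gamY`.
  have h1 := mul_le_mul_of_nonneg_left hβα ha.le
  have h2 : p.varX ^ 2 / p.gamY ^ 2 * L * β ≤ p.varX ^ 2 / p.gamY ^ 2 * L * τ := by linarith
  have h3 := le_of_mul_le_mul_left h2 (by positivity)
  rw [hl, sub_self, zero_div, zero_mul, zero_add]
  exact mul_nonpos_of_nonneg_of_nonpos (by positivity) (by linarith)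

/-! ### Matching the limits with the stated expressions -/

lemma xi_eq (hs : 0 < p.covY) (h1 : p.rhoX < 1) :
    p.xi = p.covX * p.gamY / (p.gamX * p.covY) := by
  have hX := hp.varX_pos
  have hY := hp.varY_pos
  have h : 1 - p.rhoX ≠ 0 := by linarith
  rw [xi, rhoY, covX, gamX, hp.gamY_eq]
  field_simp

omit hp in
lemma _root_.SymGauss.gap_eq (p : SymGauss) : p.gamX ^ 2 * p.gamY⁻¹ = p.gap :=
  (div_eq_mul_inv _ _).symm

lemma Dth0_sub (hs : 0 < p.covY) (D : ℝ) : p.Dth0 - D = p.gap - p.excess D := by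
  rw [hp.Dth0_eq hs, excess]; ring

/-- The crossing point dominates the stationary point in the limit. -/
lemma statLim_le_crossLim (hs : 0 < p.covY) (hr : 0 < p.covX) (h1 : p.rhoX < 1) {D : ℝ}
    (hK : p.excess D < p.gap)
    (h : p.excess D * (p.gap - p.excess D) ≤ p.xi ^ 2 * p.gap ^ 2) :
    p.statLim D ≤ p.crossLim D := by
  have hg := hp.gamY_pos
  have hk : 0 < p.gamX := mul_pos (by linarith) hp.varX_pos
  have hd := sub_pos.2 hK
  have e : p.xi ^ 2 * p.gap ^ 2 = p.gap * p.gamY * (p.covX / p.covY) ^ 2 := by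
    rw [hp.xi_eq hs h1, gap]; field_simp
  rw [e] at h
  rw [statLim, crossLim, sub_le_iff_le_add, div_le_iff₀ (by positivity)]
  rw [show p.excess D * p.gamY / (p.gap - p.excess D) + p.gamY =
    p.gap * p.gamY / (p.gap - p.excess D) by field_simp; ring, div_mul_eq_mul_div, le_div_iff₀ hd]
  exact h

/-- The stationary point dominates the crossing point in the limit. -/
lemma crossLim_le_statLim (hs : 0 < p.covY) (hr : 0 < p.covX) (h1 : p.rhoX < 1) {D : ℝ}
    (hK : p.excess D < p.gap)
    (h : p.xi ^ 2 * p.gap ^ 2 ≤ p.excess D * (p.gap - p.excess D)) :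
    p.crossLim D ≤ p.statLim D := by
  have hg := hp.gamY_pos
  have hk : 0 < p.gamX := mul_pos (by linarith) hp.varX_pos
  have hd := sub_pos.2 hK
  have e : p.xi ^ 2 * p.gap ^ 2 = p.gap * p.gamY * (p.covX / p.covY) ^ 2 := by
    rw [hp.xi_eq hs h1, gap]; field_simp
  rw [e] at h
  rw [statLim, crossLim, le_sub_iff_add_le, le_div_iff₀ (by positivity)]
  rw [show p.excess D * p.gamY / (p.gap - p.excess D) + p.gamY =
    p.gap * p.gamY / (p.gap - p.excess D) by field_simp; ring, div_mul_eq_mul_div, div_le_iff₀ hd]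
  exact h

lemma isBigO_upperInf1 (hs : 0 < p.covY) (hr : 0 < p.covX) (h1 : p.rhoX < 1) {D : ℝ}
    (hd : 0 < p.excess D) (hK : p.excess D < p.gap) (hD : D < p.varX)
    (h : p.excess D * (p.gap - p.excess D) ≤ p.xi ^ 2 * p.gap ^ 2) :
    (fun L : ℕ => p.lowerR L D - p.upperInf1 L D) =O[atTop] fun L : ℕ => 1 / (L : ℝ) := by
  have hg := hp.gamY_pos
  have hk : 0 < p.gamX := mul_pos (by linarith) hp.varX_pos
  have hK' := sub_pos.2 hK
  refine (hp.isBigO_lowerR_of_lt_gap hs hr hk hd hK hD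
    (max_eq_left (hp.statLim_le_crossLim hs hr h1 hK h))).congr_left fun L => ?_
  have e1 : p.covY / (p.crossLim D + p.gamY) = p.covY * (p.gap - p.excess D) / p.gamX ^ 2 := by
    have : p.crossLim D + p.gamY = p.gamX ^ 2 / (p.gap - p.excess D) := by
      have : p.gamX ^ 2 = p.gap * p.gamY := by rw [gap]; field_simp
      rw [this, crossLim]; field_simp; ring
    rw [this]; field_simp
  have e2 : (p.skew ^ 2 / p.gamY + (p.covX / p.covY) ^ 2 * p.crossLim D) / (2 * p.excess D) - 1 / 2 =
      (p.gap - p.excess D - p.xi * p.gap) ^ 2 / (2 * (p.gap - p.excess D) * p.excess D) := by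
    -- Indeed `skew = (1 - ξ) * gamX`.
    have e3 : p.skew ^ 2 / p.gamY = (1 - p.xi) ^ 2 * p.gap := by
      rw [skew, hp.xi_eq hs h1, gap]; field_simp
    have e4 : (p.covX / p.covY) ^ 2 * p.crossLim D =
        p.xi ^ 2 * p.gap * p.excess D / (p.gap - p.excess D) := by
      have : (p.covX / p.covY) ^ 2 = p.xi ^ 2 * p.gap / p.gamY := by
        rw [hp.xi_eq hs h1, gap]; field_simp
      rw [this, crossLim]; field_simp
    rw [e3, e4]
    have := hK'.ne'
    field_simp; ring
  rw [upperInf1, gap_eq, ← excess, hp.Dth0_sub hs, e1,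
    show p.Dth0 - p.xi * p.gap - D = p.Dth0 - D - p.xi * p.gap by ring, hp.Dth0_sub hs, ← e2]
  ring

lemma isBigO_lowerInf1 (hs : 0 < p.covY) (hr : 0 < p.covX) (h1 : p.rhoX < 1) {D : ℝ}
    (hd : 0 < p.excess D) (hK : p.excess D < p.gap) (hD : D < p.varX)
    (h : p.xi ^ 2 * p.gap ^ 2 ≤ p.excess D * (p.gap - p.excess D)) :
    (fun L : ℕ => p.lowerR L D - p.lowerInf1 L D) =O[atTop] fun L : ℕ => 1 / (L : ℝ) := by
  have hg := hp.gamY_pos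
  have hX := hp.varX_pos
  have hY := hp.varY_pos
  have h1' : 1 - p.rhoX ≠ 0 := by linarith
  have hk : 0 < p.gamX := mul_pos (by linarith) hp.varX_pos
  have hKpos := hp.gap_pos hk
  refine (hp.isBigO_lowerR_of_lt_gap hs hr hk hd hK hD
    (max_eq_right (hp.crossLim_le_statLim hs hr h1 hK h))).congr_left fun L => ?_
  have e0 : p.rhoX ^ 2 * (1 - p.rhoY) / ((1 - p.rhoX) ^ 2 * p.rhoY) =
      p.covX ^ 2 / (p.covY * p.gap) := by
    have : p.varY - p.covY ≠ 0 := by rw [← hp.gamY_eq]; exact hg.ne'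
    rw [rhoY, gap, covX, gamX, hp.gamY_eq]; field_simp
  have e1 : p.covY / (p.statLim D + p.gamY) =
      p.gap / p.excess D * (p.covX ^ 2 / (p.covY * p.gap)) := by
    rw [statLim, sub_add_cancel]; field_simp
  have e3 : p.skew ^ 2 / p.gamY = (1 - p.xi) ^ 2 * p.gap := by
    rw [skew, hp.xi_eq hs h1, gap]; field_simp
  have e4 : (p.covX / p.covY) ^ 2 * p.statLim D = p.excess D - p.xi ^ 2 * p.gap := by
    rw [hp.xi_eq hs h1, gap, statLim]; field_simp
  rw [lowerInf1, gap_eq, ← excess, e0, e1, e3, e4, Real.log_mul (by positivity) (by positivity)]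
  field_simp
  ring

lemma isBigO_upperInf2 (hs : 0 < p.covY) (hr : 0 < p.covX) (h1 : p.rhoX < 1) {D : ℝ}
    (hK : p.excess D = p.gap) (hD : D < p.varX) :
    (fun L : ℕ => p.lowerR L D - p.upperInf2 L) =O[atTop] fun L : ℕ => 1 / √(L : ℝ) := by
  have hg := hp.gamY_pos
  have hX := hp.varX_pos
  have hY := hp.varY_pos
  have h1' : 1 - p.rhoX ≠ 0 := by linarith
  have hρ : 0 < p.rhoX := pos_of_mul_pos_left hr hX.le
  have hk : 0 < p.gamX := mul_pos (by linarith) hp.varX_pos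
  have hC : p.quadC D 0 = p.gamX ^ 2 * p.covY := by
    rw [quadC_zero, hK, gap]; field_simp
  have hV₀ : p.covX / (p.covY * p.gamX) =
      √(4 * (p.slope 0 * p.covY * p.quadC D 0)) / (2 * p.quadC D 0) := by
    rw [hC, slope_zero, show 4 * ((p.covX / p.covY) ^ 2 * p.covY * (p.gamX ^ 2 * p.covY)) =
      (2 * (p.covX * p.gamX)) ^ 2 by field_simp; ring, Real.sqrt_sq (by positivity)]
    field_simp
  refine (hp.isBigO_lowerR_of_gap_eq hs hr (hK.symm ▸ hp.gap_pos hk) hK hD hV₀ rfl).congr_left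
    fun L => ?_
  have e1 : p.covY * (p.covX / (p.covY * p.gamX)) = p.rhoX / (1 - p.rhoX) := by
    rw [covX, gamX]; field_simp
  have e2 : p.gamY * (p.covX / (p.covY * p.gamX)) = p.xi := by
    rw [hp.xi_eq hs h1]; field_simp
  have e3 : p.gamY * (p.quadB1 0 / (2 * p.quadC D 0)) - p.gamY / p.covY - p.xi ^ 2 / 2 =
      - (p.xi * (p.rhoX * p.gamX - p.gamZ + (1 - p.rhoX ^ 2) * p.varZ) /
        (2 * (1 - p.rhoX) * (p.rhoX ^ 2 * p.varX + p.rhoX * p.rhoZ * p.varZ))) := by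
    have e5 : p.rhoX ^ 2 * p.varX + p.rhoX * p.rhoZ * p.varZ = p.rhoX * p.covY := by
      rw [covY]; ring
    have e6 : p.varZ = p.gamY + p.covY - p.varX := by rw [hp.gamY_eq, varY]; ring
    have e7 : p.gamX = (1 - p.rhoX) * p.varX := rfl
    rw [hC, e5, hp.xi_eq hs h1, hp.gamZ_eq, e6, quadB1, slope_zero, lev_zero, skew, gap, covX, e7]
    field_simp
    ring
  have e4 : p.xi * (p.rhoX * p.gamX - p.gamZ + (1 - p.rhoX ^ 2) * p.varZ) /
        (4 * (1 - p.rhoX) * (p.rhoX ^ 2 * p.varX + p.rhoX * p.rhoZ * p.varZ)) =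
      p.xi * (p.rhoX * p.gamX - p.gamZ + (1 - p.rhoX ^ 2) * p.varZ) /
        (2 * (1 - p.rhoX) * (p.rhoX ^ 2 * p.varX + p.rhoX * p.rhoZ * p.varZ)) / 2 := by
    rw [div_div]; congr 1; ring
  rw [upperInf2, e1, e2, e3, e4]
  ring

lemma isBigO_upperInf3 (hs : 0 < p.covY) (hr : 0 < p.covX) {D : ℝ}
    (hd : 0 < p.excess D) (hK : p.gap < p.excess D) (hD : D < p.varX) :
    (fun L : ℕ => p.lowerR L D - p.upperInf3 D) =O[atTop] fun L : ℕ => 1 / (L : ℝ) := by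
  have hg := hp.gamY_pos
  have hY := hp.varY_pos
  have hK' := sub_pos.2 hK
  refine (hp.isBigO_lowerR_of_gap_lt hs hr hd hK hD).congr_left fun L => ?_
  have e0 : D - p.Dth0 = p.excess D - p.gap := by linarith [hp.Dth0_sub hs D]
  have e1 : p.rhoX ^ 2 * p.varX ^ 2 / (p.covY * (p.excess D - p.gap)) =
      p.covY * ((p.covX / p.covY) ^ 2 / (p.excess D - p.gap)) := by
    rw [covX]; field_simp
  have e2 : (1 - p.rhoY) / p.rhoY = p.gamY / p.covY := by
    rw [rhoY, hp.gamY_eq]; field_simp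
  have e3 : (1 - p.rhoY) * (p.varX - D) / (2 * p.rhoY * (p.excess D - p.gap)) =
      (1 - p.rhoY) / p.rhoY * (p.varX - D) / (2 * (p.excess D - p.gap)) := by
    rw [div_mul_eq_mul_div, div_div]; congr 1; ring
  have e4 : p.varX - D = p.covX ^ 2 / p.covY - (p.excess D - p.gap) := by
    rw [excess, hp.dminInf_eq hs, varX_eq]; ring
  rw [upperInf3, e0, e1, e3, e2, e4]
  have := hK'.ne'
  field_simp

lemma isBigO_lowerInf2 (hs : 0 < p.covY) (hr : p.rhoX = 0) {D : ℝ}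
    (hd : 0 < p.excess D) (hD : D < p.varX) :
    (fun L : ℕ => p.lowerR L D - p.lowerInf2 L D) =O[atTop] fun L : ℕ => 1 / (L : ℝ) := by
  have hg := hp.gamY_pos
  have hX := hp.varX_pos
  have hr' : p.covX = 0 := by rw [covX, hr, zero_mul]
  have hk : p.gamX = p.varX := by rw [gamX, hr]; ring
  refine (hp.isBigO_lowerR_of_covX_eq_zero hs hr' (hk ▸ hX) hd hD).congr_left fun L => ?_
  have hd' : p.excess D = D - p.varX + p.gap := by
    rw [excess, hp.dminInf_eq hs, hr', hk]; ring
  have e1 : p.varX ^ 2 / (p.gamY * D - p.varX * p.gamZ) = p.gap / p.excess D := by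
    have : p.gamY * D - p.varX * p.gamZ = p.gamY * p.excess D := by
      rw [hd', hp.gamZ_eq, gap, hk]; field_simp; ring
    rw [this, gap, hk]; field_simp
  have e2 : p.skew ^ 2 / p.gamY = p.gap := by rw [skew, hr', gap]; simp
  rw [lowerInf2, e1, e2, ← hk, gap_eq, hk, ← hd']
  have : D - p.varX = p.excess D - p.gap := by rw [hd']; ring
  rw [this]
  field_simp
  ring

lemma eventually_isLeast {D : ℝ} (hD : D ∈ Set.Ioo p.dminInf p.varX) :
    ∀ᶠ L : ℕ in atTop, IsLeast (p.values L D) (p.lowerR L D) := by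
  have hd : 0 < p.excess D := sub_pos.2 hD.1
  have key : ∀ᶠ L : ℕ in atTop, ∃ m, IsLeast (p.values L D) m := by
    rcases hp.covY_nonneg.eq_or_lt with hs | hs
    · filter_upwards [eventually_ge_atTop 1] with L hL
      exact ⟨_, hp.isLeast_of_covY_eq_zero hs.symm hD hL⟩
    rcases hp.covX_nonneg.eq_or_lt with hr | hr
    · have hk : 0 < p.gamX := by
        have := hp.varX_pos
        rw [varX_eq, ← hr, zero_add] at this; exact this
      exact (hp.eventually_isLeast_lamY hs hr.symm hd hk hD.2).mono fun L h => ⟨_, h⟩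
    rcases lt_or_ge (p.excess D) p.gap with hK | hK
    · have hk : 0 < p.gamX := by
        refine hp.gamX_nonneg.lt_of_ne fun h => ?_
        rw [gap, ← h] at hK
        simp at hK; linarith
      exact (hp.eventually_isLeast_max hs hr hk hd hD.2).mono fun L h => ⟨_, h⟩
    -- This branch includes `gamX = 0`, that is `ρ_X = 1`, where the distortion constraint no longer
    -- involves `β`.
    · exact (hp.eventually_isLeast_cross hs hr hd hK hD.2).mono fun L h => ⟨_, h⟩
  filter_upwards [key] with L ⟨m, hm⟩
  rwa [lowerR_eq_of_isLeast hm]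

end Admissible
end SymGauss
end

/-! ### Assembly of the cases -/

theorem theorem5 (p : SymGauss)
    (hvarX : 0 < p.varX) (hvarZ : 0 ≤ p.varZ)
    (hrhoX : p.rhoX ∈ Set.Icc (0 : ℝ) 1) (hrhoZ : p.rhoZ ∈ Set.Icc (0 : ℝ) 1)
    (hgamY : 0 < p.gamY)
    (D : ℝ) (hD : D ∈ Set.Ioo p.dminInf p.varX) :
    -- the program defining the lower bound has a minimum for all large `L`
    (∀ᶠ L : ℕ in atTop, IsLeast (p.values L D) (p.lowerR L D)) ∧
    -- 1. uncorrelated coordinates of `Y`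
    (p.covY = 0 → ∀ L : ℕ, 1 ≤ L → p.lowerR L D = p.upperInf L D) ∧
    -- 2. `ρ_X > 0` and `ξ ≥ 1/2` (with `ξ = +∞` for `ρ_X = 1`)
    (0 < p.covY → 0 < p.rhoX → (p.rhoX = 1 ∨ 1 / 2 ≤ p.xi) →
      (D < p.Dth0 →
        (fun L : ℕ => p.lowerR L D - p.upperInf1 L D) =O[atTop] fun L : ℕ => 1 / (L : ℝ)) ∧
      (D = p.Dth0 →
        (fun L : ℕ => p.lowerR L D - p.upperInf2 L) =O[atTop] fun L : ℕ => 1 / √(L : ℝ)) ∧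
      (p.Dth0 < D →
        (fun L : ℕ => p.lowerR L D - p.upperInf3 D) =O[atTop] fun L : ℕ => 1 / (L : ℝ))) ∧
    -- 3. `ρ_X > 0` and `ξ < 1/2`
    (0 < p.covY → 0 < p.rhoX → p.rhoX < 1 → p.xi < 1 / 2 →
      (D ≤ p.Dth1 →
        (fun L : ℕ => p.lowerR L D - p.upperInf1 L D) =O[atTop] fun L : ℕ => 1 / (L : ℝ)) ∧
      (p.Dth1 < D → D < p.Dth2 →
        (fun L : ℕ => p.lowerR L D - p.lowerInf1 L D) =O[atTop] fun L : ℕ => 1 / (L : ℝ)) ∧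
      (p.Dth2 ≤ D → D < p.Dth0 →
        (fun L : ℕ => p.lowerR L D - p.upperInf1 L D) =O[atTop] fun L : ℕ => 1 / (L : ℝ)) ∧
      (D = p.Dth0 →
        (fun L : ℕ => p.lowerR L D - p.upperInf2 L) =O[atTop] fun L : ℕ => 1 / √(L : ℝ)) ∧
      (p.Dth0 < D →
        (fun L : ℕ => p.lowerR L D - p.upperInf3 D) =O[atTop] fun L : ℕ => 1 / (L : ℝ))) ∧
    -- 4. `ρ_X = 0`
    (0 < p.covY → p.rhoX = 0 →
      (fun L : ℕ => p.lowerR L D - p.lowerInf2 L D) =O[atTop] fun L : ℕ => 1 / (L : ℝ)) := by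
  have hp : p.Admissible := ⟨hvarX, hvarZ, hrhoX, hrhoZ, hgamY⟩
  have hd : 0 < p.excess D := sub_pos.2 hD.1
  have hr : 0 < p.rhoX → 0 < p.covX := fun h => mul_pos h hvarX
  have hgap : p.rhoX = 1 → p.gap = 0 := fun h => by
    rw [SymGauss.gap, SymGauss.gamX, h]; simp
  refine ⟨hp.eventually_isLeast hD,
    fun hs L hL => SymGauss.lowerR_eq_of_isLeast (hp.isLeast_of_covY_eq_zero hs hD hL),
    fun hs hρ hξ => ?_, fun hs hρ h1 hξ => ?_, fun hs hρ => hp.isBigO_lowerInf2 hs hρ hd hD.2⟩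
  · have hsub := hp.Dth0_sub hs D
    -- For `ρ_X = 1` the gap is zero, so `D` exceeds `Dth0` and only the third expression applies;
    -- it does not involve `ξ`.
    have hlt1 : p.excess D ≤ p.gap → p.rhoX < 1 := fun h =>
      hrhoX.2.lt_of_ne fun h' => by rw [hgap h'] at h; linarith
    refine ⟨fun h => ?_, fun h => ?_,
      fun h => hp.isBigO_upperInf3 hs (hr hρ) hd (by linarith) hD.2⟩
    · have h1 := hlt1 (by linarith)
      have hξ' : 1 / 2 ≤ p.xi := hξ.resolve_left h1.ne
      refine hp.isBigO_upperInf1 hs (hr hρ) h1 hd (by linarith) hD.2 ?_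
      have : (1 / 2) ^ 2 * p.gap ^ 2 ≤ p.xi ^ 2 * p.gap ^ 2 := by gcongr
      -- This is `excess * (gap - excess) ≤ gap ^ 2 / 4 ≤ ξ ^ 2 * gap ^ 2`.
      nlinarith [sq_nonneg (p.gap - 2 * p.excess D)]
    · exact hp.isBigO_upperInf2 hs (hr hρ) (hlt1 (by linarith)) (by linarith) hD.2
  · have hsub := hp.Dth0_sub hs D
    have hk : 0 < p.gamX := mul_pos (by linarith) hvarX
    have hK := hp.gap_pos hk
    have hξ0 : 0 < p.xi := by
      have := hr hρ
      rw [hp.xi_eq hs h1]; positivity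
    have hq2 : √(1 - 4 * p.xi ^ 2) ^ 2 = 1 - 4 * p.xi ^ 2 := Real.sq_sqrt (by nlinarith)
    have hq0 := Real.sqrt_nonneg (1 - 4 * p.xi ^ 2)
    -- Since `4 * excess * (gap - excess) = gap ^ 2 - (gap - 2 * excess) ^ 2`, the comparison
    -- reduces to `|gap - 2 * excess|` against `q * gap`, where `q` is the square root. The
    -- thresholds are the points of equality.
    have hid : 4 * (p.xi ^ 2 * p.gap ^ 2) = p.gap ^ 2 - (√(1 - 4 * p.xi ^ 2) * p.gap) ^ 2 := by
      rw [mul_pow, hq2]; ring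
    have hq1 : √(1 - 4 * p.xi ^ 2) < 1 := by nlinarith
    rw [SymGauss.Dth1, SymGauss.Dth2, p.gap_eq]
    set q := √(1 - 4 * p.xi ^ 2)
    have hqK : 0 ≤ q * p.gap := by positivity
    have hqK1 : q * p.gap < p.gap := by nlinarith
    refine ⟨fun h => ?_, fun h h' => ?_, fun h h' => ?_, fun h => ?_,
      fun h => hp.isBigO_upperInf3 hs (hr hρ) hd (by linarith) hD.2⟩
    · refine hp.isBigO_upperInf1 hs (hr hρ) h1 hd (by linarith) hD.2 ?_
      have : q * p.gap ≤ p.gap - 2 * p.excess D := by linarith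
      nlinarith [pow_le_pow_left₀ hqK this 2]
    · refine hp.isBigO_lowerInf1 hs (hr hρ) h1 hd (by linarith) hD.2 ?_
      have : |p.gap - 2 * p.excess D| ≤ q * p.gap := abs_le.2 ⟨by linarith, by linarith⟩
      nlinarith [sq_le_sq' (abs_le.1 this).1 (abs_le.1 this).2]
    · refine hp.isBigO_upperInf1 hs (hr hρ) h1 hd (by linarith) hD.2 ?_
      have : q * p.gap ≤ 2 * p.excess D - p.gap := by linarith
      nlinarith [pow_le_pow_left₀ hqK this 2]
    · exact hp.isBigO_upperInf2 hs (hr hρ) h1 (by linarith) hD.2
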